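/- **Setting.** There are $K\ge 3$ arms $\mathcal A=\{1,\dots,K\}$. The states $X^a_t$, $t\ge 0$, of the arms are independent time-homogeneous ergodic (irreducible and aperiodic) Markov chains on a common finite set $\mathcal S$, all with initial law $\phi$. An arms configuration is a triple $C=(h,P_1,P_2)$ with $h\in\mathcal A$ and ergodic transition probability matrices $P_1\ne P_2$; arm $h$ moves according to $P_C^h=P_1$ and every arm $a\neq h$ according to $P_C^a=P_2$. All arms make one transition at every time instant, whether observed or not. At time $t$ the decision maker intends to sample arm $B_t$, but (trembling hand, with a fixed $\eta\in(0,1]$) arm $A_t$ is sampled, where $P(A_t=a\mid B_t=b)=\frac{\eta}{K}+(1-\eta)\mathbb I_{\{a=b\}}$; the arm $A_t$ and its state $\bar X_t=X_t^{A_t}$ are then observed. Under every policy the first $K$ samples are $A_0=1,\dots,A_{K-1}=K$. Afterwards a policy $\pi$ decides at each time, from the history $(B_s,A_s,\bar X_s)_{s\le t}$, either to choose $B_{t+1}$ by a deterministic or randomised rule, or to stop and declare an odd arm; $\tau(\pi)$ is the stopping time and $\theta(\tau(\pi))$ the declared arm. $P^\pi(\cdot|C)$, $E^\pi[\cdot|C]$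 denote probability and expectation under $\pi$ and $C$. For $\epsilon>0$, $\Pi(\epsilon)$ is the set of policies with $P^\pi\big(\tau(\pi)<\infty,\ \theta(\tau(\pi))\ne h\mid C\big)\le\epsilon$ for every arms configuration $C=(h,P_1,P_2)$. Let $\mathbb S$ be the set of pairs $(\underline d,\underline i)$ of arm delays $\underline d\in\{1,2,\dots\}^K$ with pairwise distinct entries, one of them equal to $1$, and last observed states $\underline i\in\mathcal S^K$. For $b\in\mathcal A$ let $Q_C(\underline d',\underline i'\mid\underline d,\underline i,b)$ equal $\left(\frac{\eta}{K}+(1-\eta)\mathbb I_{\{a=b\}}\right)(P_C^a)^{d_a}(i'_a|i_a)$ if, for some arm $a$, $d'_a=1$ and $d'_{\tilde a}=d_{\tilde a}+1$, $i'_{\tilde a}=i_{\tilde a}$ for all $\tilde a\neq a$, and $0$ otherwise. A stationary randomised strategy (SRS) $\pi^\lambda$ is given by probability distributions $\lambda(\cdot|\underline d,\underline i)$ on $\mathcal A$, $(\underline d,\underline i)\in\mathbb S$; let $\mu^\lambda$ be the stationary distribution of the Markov chain on $\mathbb S$ with transition probabilities $\sum_b\lambda(b|\underline d,\underline i)\,Q_C(\cdot\mid\underline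 d,\underline i,b)$, and let $$\nu^\lambda(\underline d,\underline i,a)=\mu^\lambda(\underline d,\underline i)\left(\tfrac{\eta}{K}+(1-\eta)\lambda(a|\underline d,\underline i)\right).$$ For $C'=(h',P_1',P_2')$ let $k_{CC'}(\underline d,\underline i,a)=D\big((P_C^a)^{d_a}(\cdot|i_a)\,\|\,(P_{C'}^a)^{d_a}(\cdot|i_a)\big)\in[0,\infty]$, where $D$ is the Kullback–Leibler divergence and $P^d(\cdot|i)$ is the $i$-th row of $P^d$. **Proposition.** For every arms configuration $C=(h,P_1,P_2)$, $$\liminf_{\epsilon\downarrow0}\ \inf_{\pi\in\Pi(\epsilon)}\frac{E^\pi[\tau(\pi)|C]}{\log(1/\epsilon)}\ \ge\ \frac1{R^*(h,P_1,P_2)},$$ where $$R^*(h,P_1,P_2)=\sup_{\pi^\lambda\in\Pi_{\mathsf{SRS}}}\ \inf_{\substack{C'=(h',P_1',P_2')\\ h'\ne h,\ P_1'\ne P_2'}}\ \sum_{(\underline d,\underline i)\in\mathbb S}\sum_{a=1}^K\nu^\lambda(\underline d,\underline i,a)\,k_{CC'}(\underline d,\underline i,a),$$ the infimum being over all arms configurations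 $C'$ with odd arm $h'\neq h$. -/

import Mathlib

open MeasureTheory ProbabilityTheory Filter Topology
open scoped ENNReal

namespace OddArm

/-- The `i`-th row `P(· | i)` of a transition probability matrix, as a probability distribution.
Transition probability matrices form the submonoid `Matrix.rowStochastic`, so that `row (P ^ d) i`
is the `d`-step law `P^d(· | i)`. -/
noncomputable def row {S : Type*} [Fintype S] [DecidableEq S] (P : Matrix.rowStochastic ℝ S)
    (i : S) : PMF S :=
  PMF.ofFintype (fun j => ENNReal.ofReal ((P : Matrix S S ℝ) i j)) (by
    rw [← ENNReal.ofReal_sum_of_nonneg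
      (fun j _ => Matrix.nonneg_of_mem_rowStochastic P.2),
      Matrix.sum_row_of_mem_rowStochastic P.2, ENNReal.ofReal_one])

/-- An arms configuration `C = (h, P₁, P₂)`: the odd arm `h` has transition probability matrix
`P₁`, every other arm has `P₂ ≠ P₁`, and both matrices are ergodic, that is, irreducible and
aperiodic (some power has only positive entries). -/
structure ArmsConfig (K : ℕ) (S : Type*) [Fintype S] [DecidableEq S] where
  h : Fin K
  P₁ : Matrix.rowStochastic ℝ S
  P₂ : Matrix.rowStochastic ℝ S
  ergodic₁ : (P₁ : Matrix S S ℝ).IsPrimitive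
  ergodic₂ : (P₂ : Matrix S S ℝ).IsPrimitive
  ne : P₁ ≠ P₂

/-- The transition probability matrix of arm `a` under the configuration `C`. -/
noncomputable def ArmsConfig.tpm {K : ℕ} {S : Type*} [Fintype S] [DecidableEq S]
    (C : ArmsConfig K S) (a : Fin K) : Matrix.rowStochastic ℝ S :=
  if a = C.h then C.P₁ else C.P₂

/-- The trembling hand: the law of the arm that is actually sampled when arm `b` is intended,
`P(A = a | B = b) = η / K + (1 - η) 𝟙{a = b}`. -/
noncomputable def tremble {K : ℕ} (η : Set.Ioc (0 : ℝ) 1) (b : Fin K) : PMF (Fin K) :=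
  PMF.ofFintype (fun a => ENNReal.ofReal ((η : ℝ) / K + (1 - η) * if a = b then 1 else 0)) (by
    have hK : (0 : ℝ) < K := by exact_mod_cast Fin.pos b
    rw [← ENNReal.ofReal_sum_of_nonneg, ← ENNReal.ofReal_one]
    · congr 1
      rw [Finset.sum_add_distrib, ← Finset.mul_sum]
      simp
      field_simp
      ring
    · intro a _
      have h1 : (0 : ℝ) ≤ 1 - η := sub_nonneg.2 η.2.2
      have h2 : (0 : ℝ) ≤ (η : ℝ) / K := div_nonneg η.2.1.le hK.le
      split_ifs <;> simp <;> linarith)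

/-- What happens at one time instant: the intended arm `B_t`, the sampled arm `A_t`, and the
states of all the arms `(X_t^a)_a`. -/
abbrev Step (K : ℕ) (S : Type*) : Type _ := (Fin K × Fin K) × (Fin K → S)

/-- What the decision entity sees at one time instant: `(B_t, A_t, X̄_t)`, where `X̄_t` is the
state of the sampled arm. -/
def Step.observe {K : ℕ} {S : Type*} (s : Step K S) : (Fin K × Fin K) × S :=
  (s.1, s.2 s.1.2)

/-- A policy: at each time `n`, given the observed history `(B_s, A_s, X̄_s)_{s ≤ n}`, either
intend to sample an arm `B_{n+1}` drawn from a distribution on the arms (`Sum.inl`), or stop and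
declare an odd arm (`Sum.inr`). Every policy starts by sampling each arm once, in order, so its
values at times `n + 1 < K` are not used. -/
abbrev Policy (K : ℕ) (S : Type*) : Type _ :=
  (n : ℕ) → (Finset.Iic n → (Fin K × Fin K) × S) → PMF (Fin K) ⊕ Fin K

/-- The law of `(B_{n+1}, A_{n+1})` given the observed history up to time `n`. For `n + 1 < K` the
arm is the `(n+1)`-th (arms are numbered from `0`). What is sampled after the policy has stopped
is immaterial; by convention the declared arm is intended forever. -/
noncomputable def armsLaw {K : ℕ} {S : Type*} (η : Set.Ioc (0 : ℝ) 1) (π : Policy K S) (n : ℕ)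
    (o : Finset.Iic n → (Fin K × Fin K) × S) : PMF (Fin K × Fin K) :=
  if hn : n + 1 < K then PMF.pure (⟨n + 1, hn⟩, ⟨n + 1, hn⟩)
  else (Sum.elim id PMF.pure (π n o)).bind fun b => (tremble η b).map fun a => (b, a)

section Dynamics

variable {K : ℕ} {S : Type*} [Fintype S] [DecidableEq S] [MeasurableSpace S]
  [DiscreteMeasurableSpace S]

/-- The joint law of all the arm states at the next time instant: each arm, sampled or not, makes
one transition of its own Markov chain, independently of the other arms. -/
noncomputable def statesLaw (C : ArmsConfig K S) (x : Fin K → S) : Measure (Fin K → S) :=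
  Measure.pi fun a => (row (C.tpm a) (x a)).toMeasure

instance (C : ArmsConfig K S) (x : Fin K → S) : IsProbabilityMeasure (statesLaw C x) := by
  unfold statesLaw; infer_instance

/-- One step of the process: the law of time instant `n + 1` given everything up to time `n`. The
policy sees only the observed history; the arms evolve irrespective of the sampling. -/
noncomputable def stepKernel (η : Set.Ioc (0 : ℝ) 1) (π : Policy K S) (C : ArmsConfig K S)
    (n : ℕ) : Kernel (Finset.Iic n → Step K S) (Step K S) :=
  Kernel.ofFunOfCountable fun w =>
    (armsLaw η π n fun s => (w s).observe).toMeasure.prod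
      (statesLaw C (w ⟨n, Finset.mem_Iic.2 le_rfl⟩).2)

instance (η : Set.Ioc (0 : ℝ) 1) (π : Policy K S) (C : ArmsConfig K S) (n : ℕ) :
    IsMarkovKernel (stepKernel η π C n) :=
  ⟨fun w => by
    change IsProbabilityMeasure ((armsLaw η π n fun s => (w s).observe).toMeasure.prod
      (statesLaw C (w ⟨n, Finset.mem_Iic.2 le_rfl⟩).2))
    infer_instance⟩

/-- The law of time instant `0`: the first arm is sampled, and the initial states of the arms are
independent with common law `φ`. -/
noncomputable def initLaw (φ : PMF S) (C : ArmsConfig K S) : Measure (Step K S) :=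
  (Measure.dirac ((⟨0, Fin.pos C.h⟩, ⟨0, Fin.pos C.h⟩) : Fin K × Fin K)).prod
    (Measure.pi fun _ => φ.toMeasure)

/-- `P^π(· | C)`: the law of the whole process under the policy `π` and the configuration `C`. -/
noncomputable def law (η : Set.Ioc (0 : ℝ) 1) (φ : PMF S) (π : Policy K S) (C : ArmsConfig K S) :
    Measure (ℕ → Step K S) :=
  Kernel.trajMeasure (X := fun _ => Step K S) (initLaw φ C) (stepKernel η π C)

end Dynamics

/-- The decision of the policy at time `n`, along the trajectory `ω`. -/
noncomputable def decision {K : ℕ} {S : Type*} (π : Policy K S) (ω : ℕ → Step K S) (n : ℕ) :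
    PMF (Fin K) ⊕ Fin K :=
  π n fun s => (ω s).observe

/-- The stopping time `τ(π)`: the first time `n`, once every arm has been sampled, at which the
policy stops (`⊤` if it never does). -/
noncomputable def stopTime {K : ℕ} {S : Type*} (π : Policy K S) (ω : ℕ → Step K S) : ℕ∞ :=
  ⨅ (n : ℕ) (_ : K ≤ n + 1 ∧ (decision π ω n).isRight), (n : ℕ∞)

/-- The event that the policy stops and declares an arm other than `h`. -/
def wrongDecision {K : ℕ} {S : Type*} (π : Policy K S) (h : Fin K) : Set (ℕ → Step K S) :=
  {ω | ∃ n : ℕ, stopTime π ω = n ∧ ∃ θ : Fin K, decision π ω n = Sum.inr θ ∧ θ ≠ h}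

section Bound

variable {K : ℕ} {S : Type*} [Fintype S] [DecidableEq S] [MeasurableSpace S]
  [DiscreteMeasurableSpace S]

/-- `Π(ε)`: the policies whose error probability at stoppage is at most `ε` under every
configuration. -/
def admissible (η : Set.Ioc (0 : ℝ) 1) (φ : PMF S) (ε : ℝ) : Set (Policy K S) :=
  {π | ∀ C : ArmsConfig K S, law η φ π C (wrongDecision π C.h) ≤ ENNReal.ofReal ε}

/-- `E^π[τ(π) | C]`, which may be infinite. -/
noncomputable def expectedStopTime (η : Set.Ioc (0 : ℝ) 1) (φ : PMF S) (π : Policy K S)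
    (C : ArmsConfig K S) : ℝ≥0∞ :=
  ∫⁻ ω, (stopTime π ω : ℝ≥0∞) ∂(law η φ π C)

end Bound

/-- The states `(d, i)` of the controlled Markov process of arm delays and last observed states.
As one arm is sampled at each instant, the delays are distinct positive integers, one of which
is `1`. -/
structure DelayState (K : ℕ) (S : Type*) where
  d : Fin K → ℕ
  i : Fin K → S
  d_pos : ∀ a, 1 ≤ d a
  d_injective : Function.Injective d
  exists_d_eq_one : ∃ a, d a = 1

section Occupancy

variable {K : ℕ} {S : Type*} [Fintype S] [DecidableEq S]

open Classical in
/-- The controlled transition probability `Q_C(s' | s, b)`: some arm `a` is sampled, its delay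
becomes `1` and its state is refreshed by a `d_a`-step transition, while every other delay grows
by `1` and every other last observed state is kept. -/
noncomputable def transProb (η : Set.Ioc (0 : ℝ) 1) (C : ArmsConfig K S) (s : DelayState K S)
    (b : Fin K) (s' : DelayState K S) : ℝ≥0∞ :=
  ∑ a : Fin K,
    if s'.d a = 1 ∧ ∀ c, c ≠ a → s'.d c = s.d c + 1 ∧ s'.i c = s.i c then
      tremble η b a * row (C.tpm a ^ s.d a) (s.i a) (s'.i a)
    else 0

/-- `μ` is a stationary distribution of the Markov process of delays and last observed states
under the stationary randomised strategy `lam`, where `lam s` is the law of the intended arm in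
the state `s`. -/
def IsStationary (η : Set.Ioc (0 : ℝ) 1) (C : ArmsConfig K S) (lam : DelayState K S → PMF (Fin K))
    (μ : PMF (DelayState K S)) : Prop :=
  ∀ s', ∑' s, μ s * ∑ b, lam s b * transProb η C s b s' = μ s'

/-- The state-action occupancy measure `ν(s, a) = μ(s) (η / K + (1 - η) lam(a | s))`. -/
noncomputable def occupancy (η : Set.Ioc (0 : ℝ) 1) (lam : DelayState K S → PMF (Fin K))
    (μ : PMF (DelayState K S)) (s : DelayState K S) (a : Fin K) : ℝ≥0∞ :=
  μ s * (ENNReal.ofReal ((η : ℝ) / K) + ENNReal.ofReal (1 - η) * lam s a)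

variable [MeasurableSpace S]

/-- `k_{CC'}(d, i, a)`: the relative entropy of `(P_C^a)^{d_a}(· | i_a)` with respect to
`(P_{C'}^a)^{d_a}(· | i_a)`. -/
noncomputable def armDivergence (C C' : ArmsConfig K S) (s : DelayState K S) (a : Fin K) : ℝ≥0∞ :=
  InformationTheory.klDiv (row (C.tpm a ^ s.d a) (s.i a)).toMeasure
    (row (C'.tpm a ^ s.d a) (s.i a)).toMeasure

/-- `R*(h, P₁, P₂)`: the supremum over the stationary randomised strategies, each with its
stationary distribution, of the infimum over the configurations with another odd arm of the
occupancy-weighted relative entropies. -/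
noncomputable def Rstar (η : Set.Ioc (0 : ℝ) 1) (C : ArmsConfig K S) : ℝ≥0∞ :=
  ⨆ (lam : DelayState K S → PMF (Fin K)) (μ : PMF (DelayState K S))
    (_ : IsStationary η C lam μ),
    ⨅ (C' : ArmsConfig K S) (_ : C'.h ≠ C.h),
      ∑' s, ∑ a, occupancy η lam μ s a * armDivergence C C' s a

end Occupancy

end OddArm

set_option linter.unusedSectionVars false

/-! Fix `C` and let `T` be the expected number of decisions before stoppage (`totalVisits`). The
expected numbers of visits to pairs (state, intended arm), divided by `T`, form a probability
measure, and three facts control it as `ε → 0`.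

Information. Under an alternative `C'` with another odd arm, declaring `C.h` is an error. A change
of measure then forces the expected log-likelihood ratio at stoppage to be at least `log (1/ε) -
O(1)` (`log_mul_measure_declaresBy_le`). By the chain rule this expectation is a sum of one-step
divergences weighted by the visits (`ofReal_log_le_divergence`). The unobserved arms are handled by
a filter: given the observations, the arms are independent, each with its multi-step law from its
last observed state (`isFilter`). All initial states are revealed to the observer. This costs
nothing, since their law does not depend on the configuration.

Balance. The visit measure is invariant up to one unit of mass, lost at stoppage
(`tsum_visits_mul_transProb_le`).

Tightness. The trembling hand samples each arm with probability at least `η / K` at every decision,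
so large delays are rare, uniformly over policies (`mul_tsum_visits_delay_ge_le`).

If the bound failed, some `c` below `1 / R*` would satisfy `T ≤ c log (1/ε)` for suitable policies
along an ultrafilter of `ε → 0`. Since `T → ∞` (`tendsto_totalVisits`), the normalised visits
converge pointwise, lose no mass by tightness, and become exactly balanced. The limit is therefore
the occupancy of a stationary randomised strategy (`exists_isStationary`). Dividing the information
bound by `T` gives this strategy a rate of at least `1 / c` against each fixed `C'`: divergences
from a dominating `C'` are bounded by ergodicity (`exists_predictDiv_le`), and any other `C'` has
infinite rate (`IsStationary.tsum_occupancy_mul_eq_top`). Hence `R* ≥ 1 / c` (`inv_le_Rstar`), a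
contradiction. -/

namespace OddArm

/-! ### Functions of finitely many time instants and the one-step disintegration of the process law
-/

section Path

variable {K : ℕ} {S : Type*}

theorem row_apply [Fintype S] [DecidableEq S] (P : Matrix.rowStochastic ℝ S) (i j : S) :
    row P i j = ENNReal.ofReal ((P : Matrix S S ℝ) i j) := rfl

/-- The observed history up to time `n` along a trajectory. -/
def obs (n : ℕ) (ω : ℕ → Step K S) : Finset.Iic n → (Fin K × Fin K) × S :=
  fun s => (ω s).observe

/-- `F` depends on a trajectory only through the initial states of all the arms and the
observations up to time `n`. -/
def ObservedBy {β : Type*} (n : ℕ) (F : (ℕ → Step K S) → β) : Prop :=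
  ∀ ω ω', (ω 0).2 = (ω' 0).2 → (∀ k ≤ n, (ω k).observe = (ω' k).observe) → F ω = F ω'

theorem ObservedBy.dependsOn {β : Type*} {n : ℕ} {F : (ℕ → Step K S) → β}
    (hF : ObservedBy n F) : DependsOn F (Set.Iic n) :=
  fun ω ω' h => hF ω ω' (by rw [h 0 (Nat.zero_le n)]) fun k hk => by rw [h k hk]

theorem ObservedBy.mono {β : Type*} {m n : ℕ} (h : m ≤ n) {F : (ℕ → Step K S) → β}
    (hF : ObservedBy m F) : ObservedBy n F :=
  fun ω ω' h0 h1 => hF ω ω' h0 fun k hk => h1 k (hk.trans h)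

theorem exists_eq_comp_frestrictLe [Nonempty (ℕ → Step K S)] {β : Type*} {n : ℕ}
    {F : (ℕ → Step K S) → β} (hF : DependsOn F (Set.Iic n)) :
    ∃ G : (Finset.Iic n → Step K S) → β, F = G ∘ Preorder.frestrictLe n := by
  obtain ⟨ω₀⟩ := ‹Nonempty (ℕ → Step K S)›
  refine ⟨fun w => F fun k => if h : k ∈ Finset.Iic n then w ⟨k, h⟩ else ω₀ k, ?_⟩
  funext ω
  refine hF fun k hk => ?_
  have hk' : k ∈ Finset.Iic n := Finset.mem_Iic.2 hk
  simp [Preorder.frestrictLe, hk']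

variable [Fintype S]

theorem measurable_of_dependsOn [MeasurableSpace S] [DiscreteMeasurableSpace S] {β : Type*}
    [MeasurableSpace β] {n : ℕ} {F : (ℕ → Step K S) → β} (hF : DependsOn F (Set.Iic n)) :
    Measurable F := by
  rcases isEmpty_or_nonempty (ℕ → Step K S) with he | he
  · exact measurable_of_empty F
  obtain ⟨G, rfl⟩ := exists_eq_comp_frestrictLe hF
  exact (measurable_of_countable G).comp (by fun_prop)

theorem finite_range_of_dependsOn {β : Type*} {n : ℕ}
    {F : (ℕ → Step K S) → β} (hF : DependsOn F (Set.Iic n)) : (Set.range F).Finite := by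
  rcases isEmpty_or_nonempty (ℕ → Step K S) with he | he
  · simp [Set.range_eq_empty]
  obtain ⟨G, rfl⟩ := exists_eq_comp_frestrictLe hF
  exact (Set.finite_range G).subset (Set.range_comp_subset_range _ _)

variable [DecidableEq S] [MeasurableSpace S] [DiscreteMeasurableSpace S]

instance (η : Set.Ioc (0 : ℝ) 1) (φ : PMF S) (π : Policy K S) (C : ArmsConfig K S) :
    IsProbabilityMeasure (law η φ π C) := by
  have : IsProbabilityMeasure (initLaw φ C) := by unfold initLaw; infer_instance
  unfold law; infer_instance

theorem stepKernel_singleton (η : Set.Ioc (0 : ℝ) 1) (π : Policy K S) (C : ArmsConfig K S)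
    (n : ℕ) (w : Finset.Iic n → Step K S) (p : Fin K × Fin K) (x : Fin K → S) :
    stepKernel η π C n w {(p, x)} = armsLaw η π n (fun s => (w s).observe) p *
      ∏ a, row (C.tpm a) ((w ⟨n, Finset.mem_Iic.2 le_rfl⟩).2 a) (x a) := by
  change ((armsLaw η π n fun s => (w s).observe).toMeasure.prod
        (statesLaw C (w ⟨n, Finset.mem_Iic.2 le_rfl⟩).2)) {(p, x)} = _
  rw [← Set.singleton_prod_singleton, Measure.prod_prod, statesLaw, Measure.pi_singleton,
    PMF.toMeasure_apply_singleton _ _ (measurableSet_singleton _)]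
  congr 1
  refine Finset.prod_congr rfl fun a _ => ?_
  rw [PMF.toMeasure_apply_singleton _ _ (measurableSet_singleton _)]

/-- The defining property of the trajectory measure, that the next instant is drawn from
`stepKernel`, written as finite sums. Using `Function.update` keeps every integrand a function on
whole trajectories. -/
theorem lintegral_step (η : Set.Ioc (0 : ℝ) 1) (φ : PMF S) (π : Policy K S) (C : ArmsConfig K S)
    (n : ℕ) {F : (ℕ → Step K S) → ℝ≥0∞} (hF : DependsOn F (Set.Iic (n + 1))) :
    ∫⁻ ω, F ω ∂law η φ π C = ∫⁻ ω, ∑ p, armsLaw η π n (obs n ω) p *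
      ∑ x : Fin K → S, (∏ a, row (C.tpm a) ((ω n).2 a) (x a)) *
        F (Function.update ω (n + 1) (p, x)) ∂law η φ π C := by
  let G : (Finset.Iic n → Step K S) × Step K S → ℝ≥0∞ :=
    fun w => F fun k => if h : k ∈ Finset.Iic n then w.1 ⟨k, h⟩ else w.2
  have hG (ω : ℕ → Step K S) (y : Step K S) :
      F (Function.update ω (n + 1) y) = G (Preorder.frestrictLe n ω, y) := by
    refine hF fun k hk => ?_
    by_cases h : k ∈ Finset.Iic n
    · have : k ≠ n + 1 := by have := Finset.mem_Iic.1 h; omega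
      simp [h, this, Preorder.frestrictLe]
    · have : k = n + 1 := by
        have h1 : ¬ k ≤ n := fun h' => h (Finset.mem_Iic.2 h')
        have h2 : k ≤ n + 1 := hk
        omega
      simp [this]
  have hG' (ω : ℕ → Step K S) : F ω = G (Preorder.frestrictLe n ω, ω (n + 1)) := by
    rw [← hG, Function.update_eq_self]
  have hGm : Measurable G := measurable_of_countable G
  have hini : IsProbabilityMeasure (initLaw φ C) := by unfold initLaw; infer_instance
  calc ∫⁻ ω, F ω ∂law η φ π C
      = ∫⁻ w, G w ∂((law η φ π C).map fun ω => (Preorder.frestrictLe n ω, ω (n + 1))) := by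
        rw [lintegral_map hGm (by fun_prop)]
        exact lintegral_congr hG'
    _ = ∫⁻ w, G w ∂((law η φ π C).map (Preorder.frestrictLe n) ⊗ₘ stepKernel η π C n) := by
        unfold law
        rw [Kernel.map_frestrictLe_trajMeasure_compProd_eq_map_trajMeasure]
    _ = ∫⁻ ω, ∫⁻ y, G (Preorder.frestrictLe n ω, y)
          ∂stepKernel η π C n (Preorder.frestrictLe n ω) ∂law η φ π C := by
        have : IsProbabilityMeasure ((law η φ π C).map (Preorder.frestrictLe n)) :=
          Measure.isProbabilityMeasure_map (by fun_prop)
        rw [Measure.lintegral_compProd hGm, lintegral_map (measurable_of_countable _) (by fun_prop)]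
    _ = _ := by
        refine lintegral_congr fun ω => ?_
        rw [lintegral_fintype, Fintype.sum_prod_type]
        refine Finset.sum_congr rfl fun p _ => ?_
        rw [Finset.mul_sum]
        refine Finset.sum_congr rfl fun x _ => ?_
        rw [stepKernel_singleton, hG]
        change _ * (armsLaw η π n (obs n ω) p * ∏ a, row (C.tpm a) ((ω n).2 a) (x a)) = _
        ring

theorem law_map_frestrictLe_zero (η : Set.Ioc (0 : ℝ) 1) (φ : PMF S) (π : Policy K S)
    (C C' : ArmsConfig K S) :
    (law η φ π C).map (Preorder.frestrictLe 0) = (law η φ π C').map (Preorder.frestrictLe 0) := by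
  unfold law Kernel.trajMeasure
  rw [Measure.map_comp _ _ (by fun_prop), Measure.map_comp _ _ (by fun_prop),
    Kernel.traj_map_frestrictLe, Kernel.traj_map_frestrictLe, Kernel.partialTraj_self,
    Kernel.partialTraj_self]
  -- `initLaw` uses the configuration only to prove that there is an arm.
  rfl

theorem lintegral_eq_of_dependsOn_zero (η : Set.Ioc (0 : ℝ) 1) (φ : PMF S) (π : Policy K S)
    (C C' : ArmsConfig K S) {F : (ℕ → Step K S) → ℝ≥0∞} (hF : DependsOn F (Set.Iic 0)) :
    ∫⁻ ω, F ω ∂law η φ π C = ∫⁻ ω, F ω ∂law η φ π C' := by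
  have : Nonempty (ℕ → Step K S) := (law η φ π C).nonempty_of_neZero
  obtain ⟨G, rfl⟩ := exists_eq_comp_frestrictLe hF
  simp only [Function.comp_apply]
  rw [← lintegral_map (measurable_of_countable G) (by fun_prop),
    law_map_frestrictLe_zero η φ π C C', lintegral_map (measurable_of_countable G) (by fun_prop)]

theorem integrable_of_dependsOn (η : Set.Ioc (0 : ℝ) 1) (φ : PMF S) (π : Policy K S)
    (C : ArmsConfig K S) {n : ℕ} {F : (ℕ → Step K S) → ℝ} (hF : DependsOn F (Set.Iic n)) :
    Integrable F (law η φ π C) := by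
  obtain ⟨b, hb⟩ := (finite_range_of_dependsOn hF).isBounded.exists_norm_le
  exact Integrable.of_bound (measurable_of_dependsOn hF).aestronglyMeasurable b
    (ae_of_all _ fun ω => hb _ ⟨ω, rfl⟩)

end Path

theorem PMF.sum_coe {α : Type*} [Fintype α] (p : PMF α) : ∑ a, p a = 1 := by
  rw [← tsum_fintype (L := .unconditional _), p.tsum_coe]

/-! ### Delays and last observed states along a trajectory -/

section Belief

variable {K : ℕ} {S : Type*}

/-- Delays and last observed states after arm `a` has been observed in state `x`. -/
def refresh (b : (Fin K → ℕ) × (Fin K → S)) (a : Fin K) (x : S) :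
    (Fin K → ℕ) × (Fin K → S) :=
  (fun c => if c = a then 1 else b.1 c + 1, Function.update b.2 a x)

/-- The arm sampled at time `n + 1`; it is prescribed while `n + 1 < K`. -/
def nextArm (n : ℕ) (p : Fin K × Fin K) : Fin K :=
  if h : n + 1 < K then ⟨n + 1, h⟩ else p.2

/-- The delays (up to the next time instant) and the last observed states of the arms at time `n`,
with all the initial states counted as observed. -/
def belief (ω : ℕ → Step K S) : ℕ → (Fin K → ℕ) × (Fin K → S)
  | 0 => (fun _ => 1, (ω 0).2)
  | n + 1 => refresh (belief ω n) (nextArm n (ω (n + 1)).1) (ω (n + 1)).observe.2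

theorem one_le_belief (ω : ℕ → Step K S) (n : ℕ) (a : Fin K) : 1 ≤ (belief ω n).1 a := by
  cases n with
  | zero => simp [belief]
  | succ n => simp only [belief, refresh]; split_ifs <;> omega

theorem observedBy_belief (n : ℕ) : ObservedBy n fun ω : ℕ → Step K S => belief ω n := by
  induction n with
  | zero => exact fun ω ω' h _ => by simp [belief, h]
  | succ n ih =>
    intro ω ω' h0 h
    have h1 : belief ω n = belief ω' n := ih ω ω' h0 fun k hk => h k (hk.trans n.le_succ)
    have h2 := h (n + 1) le_rfl
    have h3 : (ω (n + 1)).1 = (ω' (n + 1)).1 := congrArg (fun o : (Fin K × Fin K) × S => o.1) h2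
    simp only [belief, h1, h2, h3]

theorem belief_congr {n : ℕ} {ω ω' : ℕ → Step K S} (h0 : (ω 0).2 = (ω' 0).2)
    (hk : ∀ k ≤ n, (ω k).observe = (ω' k).observe) : belief ω n = belief ω' n :=
  observedBy_belief n ω ω' h0 hk

theorem obs_congr {n : ℕ} {ω ω' : ℕ → Step K S}
    (hk : ∀ k ≤ n, (ω k).observe = (ω' k).observe) : obs n ω = obs n ω' :=
  funext fun s => hk s (Finset.mem_Iic.1 s.2)

theorem ObservedBy.update {β : Type*} {n : ℕ} {F : (ℕ → Step K S) → β} (hF : ObservedBy n F)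
    (ω : ℕ → Step K S) (y : Step K S) : F (Function.update ω (n + 1) y) = F ω :=
  hF _ _ (by simp) fun k hk => by
    have : k ≠ n + 1 := by omega
    simp [this]

theorem ObservedBy.update_succ {β : Type*} {n : ℕ} {F : (ℕ → Step K S) → β}
    (hF : ObservedBy (n + 1) F) (y : Step K S) :
    ObservedBy n fun ω => F (Function.update ω (n + 1) y) := by
  intro ω ω' h0 h
  refine hF _ _ (by simpa using h0) fun k hk => ?_
  by_cases hk' : k = n + 1
  · subst hk'; simp
  · simpa [hk'] using h k (by omega)

theorem ObservedBy.update_observe {β : Type*} {n : ℕ} {F : (ℕ → Step K S) → β}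
    (hF : ObservedBy (n + 1) F) (ω : ℕ → Step K S) (p : Fin K × Fin K) (x : Fin K → S) :
    F (Function.update ω (n + 1) (p, x)) = F (Function.update ω (n + 1) (p, fun _ => x p.2)) := by
  refine hF _ _ (by simp) fun k hk => ?_
  by_cases hk' : k = n + 1
  · subst hk'; simp [Step.observe]
  · simp [hk']

theorem belief_update (ω : ℕ → Step K S) (n : ℕ) (p : Fin K × Fin K) (x : S) :
    belief (Function.update ω (n + 1) (p, fun _ => x)) (n + 1) =
      refresh (belief ω n) (nextArm n p) x := by
  rw [belief, (observedBy_belief n).update]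
  simp [Step.observe]

end Belief

/-! ### The conditional law of the hidden arms given the observations -/

section Filtering

variable {K : ℕ} {S : Type*} [Fintype S] [DecidableEq S]

/-- `nextArm` enforces the initial round on every trajectory, even on null ones. This agrees with
the sampled arm wherever the law charges it. -/
theorem nextArm_eq_of_armsLaw_ne_zero {η : Set.Ioc (0 : ℝ) 1} {π : Policy K S} {n : ℕ}
    {o : Finset.Iic n → (Fin K × Fin K) × S} {p : Fin K × Fin K} (h : armsLaw η π n o p ≠ 0) :
    nextArm n p = p.2 := by
  by_cases hn : n + 1 < K
  · rw [armsLaw, dif_pos hn] at h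
    have : p = (⟨n + 1, hn⟩, ⟨n + 1, hn⟩) := by
      by_contra hp
      exact h (by simp [PMF.pure_apply, hp])
    simp [nextArm, hn, this]
  · simp [nextArm, hn]

theorem row_mul (P Q : Matrix.rowStochastic ℝ S) (i j : S) :
    row (P * Q) i j = ∑ z, row P i z * row Q z j := by
  have h0 (A : Matrix.rowStochastic ℝ S) (i j : S) : 0 ≤ (A : Matrix S S ℝ) i j :=
    Matrix.nonneg_of_mem_rowStochastic A.2
  have h2 (z : S) : row P i z * row Q z j = ENNReal.ofReal
      ((P : Matrix S S ℝ) i z * (Q : Matrix S S ℝ) z j) := by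
    rw [row_apply, row_apply, ENNReal.ofReal_mul (h0 _ _ _)]
  rw [row_apply, Finset.sum_congr rfl fun z _ => h2 z,
    ← ENNReal.ofReal_sum_of_nonneg fun z _ => mul_nonneg (h0 _ _ _) (h0 _ _ _)]
  rfl

theorem row_pow_succ (P : Matrix.rowStochastic ℝ S) (d : ℕ) (i j : S) :
    row (P ^ (d + 1)) i j = ∑ z, row (P ^ d) i z * row P z j := by
  rw [pow_succ, row_mul]

/-- Fubini for a finite product: the extra factor involves one coordinate only and is absorbed
there. -/
theorem sum_pi_mul_apply (f : Fin K → S → ℝ≥0∞) (g : S → ℝ≥0∞) (a : Fin K) :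
    ∑ x : Fin K → S, (∏ c, f c (x c)) * g (x a) =
      ∑ z, g z * ∏ c, if c = a then f a z else ∑ y, f c y := by
  have h1 : ∀ x : Fin K → S, (∏ c, f c (x c)) * g (x a) =
      ∏ c, f c (x c) * (if c = a then g (x c) else 1) := by
    intro x
    rw [Finset.prod_mul_distrib, Finset.prod_ite_eq' Finset.univ a]
    simp
  simp only [h1]
  rw [← Fintype.prod_sum fun c y => f c y * (if c = a then g y else 1)]
  rw [← Finset.mul_prod_erase _ _ (Finset.mem_univ a)]
  simp only [if_true]
  rw [Finset.sum_mul]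
  refine Finset.sum_congr rfl fun z _ => ?_
  rw [← Finset.mul_prod_erase _ _ (Finset.mem_univ a)]
  simp only [if_true]
  rw [← mul_assoc, mul_comm (g z)]
  congr 1
  refine Finset.prod_congr rfl fun c hc => ?_
  simp [Finset.ne_of_mem_erase hc]

theorem sum_pi_apply (f : Fin K → PMF S) (g : S → ℝ≥0∞) (a : Fin K) :
    ∑ x : Fin K → S, (∏ c, f c (x c)) * g (x a) = ∑ z, f a z * g z := by
  rw [sum_pi_mul_apply (fun c => f c) g a]
  refine Finset.sum_congr rfl fun z _ => ?_
  rw [Finset.prod_eq_single a]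
  · simp [mul_comm]
  · intro c _ hc; simp [hc, PMF.sum_coe]
  · simp

/-- Predicting two steps ahead from the beliefs, when one arm is observed after the first step. -/
theorem sum_predict (P : Fin K → Matrix.rowStochastic ℝ S) (b : (Fin K → ℕ) × (Fin K → S))
    (a : Fin K) (g : S → (Fin K → S) → ℝ≥0∞) :
    ∑ x : Fin K → S, (∏ c, row (P c ^ b.1 c) (b.2 c) (x c)) *
        ∑ y : Fin K → S, (∏ c, row (P c) (x c) (y c)) * g (x a) y =
      ∑ x, row (P a ^ b.1 a) (b.2 a) x * ∑ y : Fin K → S,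
        (∏ c, row (P c ^ (refresh b a x).1 c) ((refresh b a x).2 c) (y c)) * g x y := by
  simp only [Finset.mul_sum]
  rw [Finset.sum_comm]
  conv_rhs => rw [Finset.sum_comm]
  refine Finset.sum_congr rfl fun y _ => ?_
  calc _ = ∑ x : Fin K → S, (∏ c, row (P c ^ b.1 c) (b.2 c) (x c) * row (P c) (x c) (y c)) *
          g (x a) y := by
        refine Finset.sum_congr rfl fun x _ => ?_
        rw [Finset.prod_mul_distrib, mul_assoc]
    _ = _ := by
        rw [sum_pi_mul_apply (fun c z => row (P c ^ b.1 c) (b.2 c) z * row (P c) z (y c))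
          (fun z => g z y) a]
        refine Finset.sum_congr rfl fun z _ => ?_
        rw [← mul_assoc, mul_comm (g z y)]
        congr 1
        rw [← Finset.mul_prod_erase _ _ (Finset.mem_univ a),
          ← Finset.mul_prod_erase _ _ (Finset.mem_univ a)]
        simp only [if_true, refresh, Function.update_self, pow_one]
        rw [← mul_assoc]
        congr 1
        refine Finset.prod_congr rfl fun c hc => ?_
        have hca : c ≠ a := Finset.ne_of_mem_erase hc
        simp [hca, row_pow_succ]

variable [MeasurableSpace S] [DiscreteMeasurableSpace S]
variable (η : Set.Ioc (0 : ℝ) 1) (φ : PMF S) (π : Policy K S) (C : ArmsConfig K S)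

theorem lintegral_states_step (n : ℕ) {G : (ℕ → Step K S) → (Fin K → S) → ℝ≥0∞}
    (hG : ∀ x, ObservedBy n fun ω => G ω x) :
    ∫⁻ ω, G ω (ω (n + 1)).2 ∂law η φ π C = ∫⁻ ω, ∑ x : Fin K → S,
      (∏ a, row (C.tpm a) ((ω n).2 a) (x a)) * G ω x ∂law η φ π C := by
  rw [lintegral_step η φ π C n]
  · refine lintegral_congr fun ω => ?_
    have : ∀ p x, G (Function.update ω (n + 1) (p, x)) x = G ω x := fun p x => (hG x).update _ _
    simp only [Function.update_self, this]
    rw [← Finset.sum_mul, PMF.sum_coe, one_mul]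
  · intro ω ω' h
    dsimp only
    rw [h (n + 1) (Set.mem_Iic.2 le_rfl)]
    exact (hG _).dependsOn fun k hk => h k (le_trans hk n.le_succ)

/-- The conditional law of the states at time `n + 1` given what is observed up to time `n`. -/
def IsFilter (n : ℕ) : Prop :=
  ∀ G : (ℕ → Step K S) → (Fin K → S) → ℝ≥0∞, (∀ x, ObservedBy n fun ω => G ω x) →
    ∫⁻ ω, G ω (ω (n + 1)).2 ∂law η φ π C = ∫⁻ ω, ∑ x : Fin K → S,
      (∏ c, row (C.tpm c ^ (belief ω n).1 c) ((belief ω n).2 c) (x c)) * G ω x ∂law η φ π C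

variable {η φ π C} in
-- The sampled arm is drawn from the observations alone, independently of the next states. The
-- filter, applied to the average over the arm, therefore remains valid jointly with the arm.
theorem IsFilter.lintegral_eq {n : ℕ} (h : IsFilter η φ π C n)
    {G : (ℕ → Step K S) → (Fin K × Fin K) → (Fin K → S) → ℝ≥0∞}
    (hG : ∀ p x, ObservedBy n fun ω => G ω p x) :
    ∫⁻ ω, ∑ p, armsLaw η π n (obs n ω) p * ∑ x : Fin K → S,
        (∏ a, row (C.tpm a) ((ω n).2 a) (x a)) * G ω p x ∂law η φ π C =
      ∫⁻ ω, ∑ p, armsLaw η π n (obs n ω) p * ∑ x : Fin K → S,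
        (∏ c, row (C.tpm c ^ (belief ω n).1 c) ((belief ω n).2 c) (x c)) *
          G ω p x ∂law η φ π C := by
  have h1 := h (fun ω x => ∑ p, armsLaw η π n (obs n ω) p * G ω p x) fun x ω ω' h0 hk => by
    dsimp only
    rw [obs_congr hk]
    exact Finset.sum_congr rfl fun p _ => congrArg _ (hG p x ω ω' h0 hk)
  rw [lintegral_states_step η φ π C n
    (G := fun ω x => ∑ p, armsLaw η π n (obs n ω) p * G ω p x) fun x ω ω' h0 hk => by
    dsimp only
    rw [obs_congr hk]
    exact Finset.sum_congr rfl fun p _ => congrArg _ (hG p x ω ω' h0 hk)] at h1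
  convert h1 using 3 with ω ω
  all_goals
    simp only [Finset.mul_sum]
    rw [Finset.sum_comm]
    exact Finset.sum_congr rfl fun x _ => Finset.sum_congr rfl fun p _ => by ring

variable {η φ π C} in
theorem IsFilter.lintegral_observed_step {n : ℕ} (h : IsFilter η φ π C n)
    {F : (ℕ → Step K S) → ℝ≥0∞} (hF : ObservedBy (n + 1) F) :
    ∫⁻ ω, F ω ∂law η φ π C = ∫⁻ ω, ∑ p, armsLaw η π n (obs n ω) p *
      ∑ x, row (C.tpm p.2 ^ (belief ω n).1 p.2) ((belief ω n).2 p.2) x *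
        F (Function.update ω (n + 1) (p, fun _ => x)) ∂law η φ π C := by
  rw [lintegral_step η φ π C n hF.dependsOn]
  rw [h.lintegral_eq (G := fun ω p x => F (Function.update ω (n + 1) (p, x)))
    fun p x => hF.update_succ _]
  refine lintegral_congr fun ω => Finset.sum_congr rfl fun p _ => ?_
  congr 1
  simp only [hF.update_observe]
  exact sum_pi_apply (fun c => row (C.tpm c ^ (belief ω n).1 c) ((belief ω n).2 c))
    (fun z => F (Function.update ω (n + 1) (p, fun _ => z))) p.2

/-- Observing one arm replaces its factor in the product law by a point mass, and the other factors
are untouched by independence. One more transition raises each power by one, by Chapman–Kolmogorov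
(`sum_predict`). -/
theorem isFilter (n : ℕ) : IsFilter η φ π C n := by
  induction n with
  | zero =>
    intro G hG
    rw [lintegral_states_step η φ π C 0 hG]
    simp [belief]
  | succ n ih =>
    intro G hG
    rw [lintegral_states_step η φ π C (n + 1) hG, lintegral_step η φ π C n]
    conv_rhs => rw [ih.lintegral_observed_step (hF := by
      intro ω ω' h0 hk
      refine Finset.sum_congr rfl fun y _ => ?_
      rw [belief_congr h0 hk, show G ω y = G ω' y from hG y ω ω' h0 hk])]
    · have h1 : ∀ ω p (x y : Fin K → S), G (Function.update ω (n + 1) (p, x)) y =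
          G (Function.update ω (n + 1) (p, fun _ => x p.2)) y :=
        fun ω p x y => (hG y).update_observe ω p x
      simp only [Function.update_self]
      simp only [h1]
      rw [ih.lintegral_eq (G := fun ω p x => ∑ y : Fin K → S, (∏ c, row (C.tpm c) (x c) (y c)) *
        G (Function.update ω (n + 1) (p, fun _ => x p.2)) y)]
      · refine lintegral_congr fun ω => Finset.sum_congr rfl fun p _ => ?_
        -- On null outcomes the belief may be refreshed at an arm other than the sampled one; these
        -- terms vanish.
        by_cases hp : armsLaw η π n (obs n ω) p = 0
        · simp [hp]
        · congr 1
          rw [sum_predict C.tpm (belief ω n) p.2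
            fun z y => G (Function.update ω (n + 1) (p, fun _ => z)) y]
          simp only [belief_update, nextArm_eq_of_armsLaw_ne_zero hp]
      · intro p x ω ω' h0 hk
        refine Finset.sum_congr rfl fun y _ => ?_
        exact congrArg _ ((hG y).update_succ (p, fun _ => x p.2) ω ω' h0 hk)
    · intro ω ω' h
      refine Finset.sum_congr rfl fun y _ => ?_
      rw [h (n + 1) (Set.mem_Iic.2 le_rfl), show G ω y = G ω' y from (hG y).dependsOn h]

/-- One step of the observed process. -/
theorem lintegral_observed_step {n : ℕ} {F : (ℕ → Step K S) → ℝ≥0∞} (hF : ObservedBy (n + 1) F) :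
    ∫⁻ ω, F ω ∂law η φ π C = ∫⁻ ω, ∑ p, armsLaw η π n (obs n ω) p *
      ∑ x, row (C.tpm p.2 ^ (belief ω n).1 p.2) ((belief ω n).2 p.2) x *
        F (Function.update ω (n + 1) (p, fun _ => x)) ∂law η φ π C :=
  (isFilter η φ π C n).lintegral_observed_step hF

end Filtering

theorem PMF.sum_toReal {α : Type*} [Fintype α] (p : PMF α) : ∑ a, (p a).toReal = 1 := by
  rw [← ENNReal.toReal_sum fun a _ => p.apply_ne_top a, PMF.sum_coe, ENNReal.toReal_one]

/-! ### The one-step formula for real-valued functions -/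

section RealStep

variable {K : ℕ} {S : Type*} [Fintype S] [DecidableEq S]
variable (η : Set.Ioc (0 : ℝ) 1) (φ : PMF S) (π : Policy K S) (C : ArmsConfig K S)

/-- The conditional expectation of `F` given what is observed up to time `n`. -/
noncomputable def nextMean (n : ℕ) (F : (ℕ → Step K S) → ℝ) (ω : ℕ → Step K S) : ℝ :=
  ∑ p, (armsLaw η π n (obs n ω) p).toReal *
    ∑ x, (row (C.tpm p.2 ^ (belief ω n).1 p.2) ((belief ω n).2 p.2) x).toReal *
      F (Function.update ω (n + 1) (p, fun _ => x))

theorem observedBy_nextMean {n : ℕ} {F : (ℕ → Step K S) → ℝ} (hF : ObservedBy (n + 1) F) :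
    ObservedBy n (nextMean η π C n F) := by
  intro ω ω' h0 hk
  unfold nextMean
  rw [obs_congr hk, belief_congr h0 hk]
  exact Finset.sum_congr rfl fun p _ => congrArg _ <| Finset.sum_congr rfl fun x _ =>
    congrArg _ (hF.update_succ _ ω ω' h0 hk)

theorem nextMean_add_const (n : ℕ) (F : (ℕ → Step K S) → ℝ) (b : ℝ) (ω : ℕ → Step K S) :
    nextMean η π C n (fun ω => F ω + b) ω = nextMean η π C n F ω + b := by
  unfold nextMean
  simp only [mul_add, Finset.sum_add_distrib]
  simp only [← Finset.sum_mul, PMF.sum_toReal, one_mul]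

theorem ofReal_nextMean {n : ℕ} {F : (ℕ → Step K S) → ℝ} (hF : ∀ ω, 0 ≤ F ω) (ω : ℕ → Step K S) :
    ENNReal.ofReal (nextMean η π C n F ω) = ∑ p, armsLaw η π n (obs n ω) p *
    ∑ x, row (C.tpm p.2 ^ (belief ω n).1 p.2) ((belief ω n).2 p.2) x *
      ENNReal.ofReal (F (Function.update ω (n + 1) (p, fun _ => x))) := by
  have h1 (p : Fin K × Fin K) (x : S) : 0 ≤
      (row (C.tpm p.2 ^ (belief ω n).1 p.2) ((belief ω n).2 p.2) x).toReal *
        F (Function.update ω (n + 1) (p, fun _ => x)) := mul_nonneg ENNReal.toReal_nonneg (hF _)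
  unfold nextMean
  rw [ENNReal.ofReal_sum_of_nonneg fun p _ =>
    mul_nonneg ENNReal.toReal_nonneg (Finset.sum_nonneg fun x _ => h1 p x)]
  refine Finset.sum_congr rfl fun p _ => ?_
  rw [ENNReal.ofReal_mul ENNReal.toReal_nonneg, ENNReal.ofReal_toReal (PMF.apply_ne_top _ _),
    ENNReal.ofReal_sum_of_nonneg fun x _ => h1 p x]
  congr 1
  refine Finset.sum_congr rfl fun x _ => ?_
  rw [ENNReal.ofReal_mul ENNReal.toReal_nonneg, ENNReal.ofReal_toReal (PMF.apply_ne_top _ _)]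

theorem integral_eq_integral_nextMean [MeasurableSpace S] [DiscreteMeasurableSpace S] {n : ℕ}
    {F : (ℕ → Step K S) → ℝ} (hF : ObservedBy (n + 1) F) :
    ∫ ω, F ω ∂law η φ π C = ∫ ω, nextMean η π C n F ω ∂law η φ π C := by
  -- Adding a bound for the finitely many values of `F` reduces the claim to the nonnegative case.
  obtain ⟨b, hb⟩ := (finite_range_of_dependsOn hF.dependsOn).isBounded.exists_norm_le
  have hpos (ω : ℕ → Step K S) : 0 ≤ F ω + b := by
    have := (abs_le.1 (hb _ ⟨ω, rfl⟩)).1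
    linarith
  have hF' : ObservedBy (n + 1) fun ω => F ω + b := fun ω ω' h0 hk => by
    simp only [hF ω ω' h0 hk]
  have hM := observedBy_nextMean η π C hF'
  have hpos' (ω : ℕ → Step K S) : 0 ≤ nextMean η π C n (fun ω => F ω + b) ω :=
    Finset.sum_nonneg fun p _ => mul_nonneg ENNReal.toReal_nonneg <| Finset.sum_nonneg fun x _ =>
      mul_nonneg ENNReal.toReal_nonneg (hpos _)
  have key : ∫ ω, (F ω + b) ∂law η φ π C =
      ∫ ω, nextMean η π C n (fun ω => F ω + b) ω ∂law η φ π C := by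
    rw [integral_eq_lintegral_of_nonneg_ae (ae_of_all _ hpos)
      (measurable_of_dependsOn hF'.dependsOn).aestronglyMeasurable,
      integral_eq_lintegral_of_nonneg_ae (ae_of_all _ hpos')
      (measurable_of_dependsOn hM.dependsOn).aestronglyMeasurable,
      lintegral_observed_step η φ π C (n := n) fun ω ω' h0 hk => by rw [hF ω ω' h0 hk]]
    simp only [ofReal_nextMean η π C hpos]
  simp only [nextMean_add_const] at key
  rw [integral_add (integrable_of_dependsOn η φ π C hF.dependsOn) (integrable_const _),
    integral_add (integrable_of_dependsOn η φ π C (observedBy_nextMean η π C hF).dependsOn)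
      (integrable_const _)] at key
  exact add_right_cancel key

end RealStep

/-! ### Log-likelihood ratios and the change of measure -/

section ChangeOfMeasure

variable {K : ℕ} {S : Type*} [Fintype S] [DecidableEq S]

/-- The law of the next observation of arm `a` when the delays and last observed states
are `b`. -/
noncomputable def predictLaw (C : ArmsConfig K S) (b : (Fin K → ℕ) × (Fin K → S)) (a : Fin K) :
    PMF S :=
  row (C.tpm a ^ b.1 a) (b.2 a)

/-- Log-likelihood ratio of an observation `x` of arm `a`. -/
noncomputable def stepLlr (C C' : ArmsConfig K S) (b : (Fin K → ℕ) × (Fin K → S)) (a : Fin K)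
    (x : S) : ℝ :=
  Real.log ((predictLaw C b a x).toReal / (predictLaw C' b a x).toReal)

/-- Log-likelihood ratio of the observation made at time `n + 1`. -/
noncomputable def llrAt (C C' : ArmsConfig K S) (n : ℕ) (ω : ℕ → Step K S) : ℝ :=
  stepLlr C C' (belief ω n) (ω (n + 1)).1.2 (ω (n + 1)).observe.2

/-- Every multi-step transition that is possible under `C` is possible under `C'`. -/
def Dominated (C C' : ArmsConfig K S) : Prop :=
  ∀ (a : Fin K) (d : ℕ) (i x : S), 1 ≤ d → row (C'.tpm a ^ d) i x = 0 → row (C.tpm a ^ d) i x = 0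

theorem observedBy_llrAt (C C' : ArmsConfig K S) (n : ℕ) : ObservedBy (n + 1) (llrAt C C' n) := by
  intro ω ω' h0 hk
  have h1 := hk (n + 1) le_rfl
  have h2 : (ω (n + 1)).1 = (ω' (n + 1)).1 :=
    congrArg (fun o : (Fin K × Fin K) × S => o.1) h1
  unfold llrAt
  rw [belief_congr h0 fun k hk' => hk k (hk'.trans n.le_succ), h1, h2]

theorem llrAt_update (C C' : ArmsConfig K S) (n : ℕ) (ω : ℕ → Step K S) (p : Fin K × Fin K)
    (x : S) : llrAt C C' n (Function.update ω (n + 1) (p, fun _ => x)) =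
      stepLlr C C' (belief ω n) p.2 x := by
  unfold llrAt
  rw [(observedBy_belief n).update]
  simp [Step.observe]

theorem observedBy_sum_llrAt (C C' : ArmsConfig K S) (n : ℕ) :
    ObservedBy n fun ω => ∑ t ∈ Finset.range n, llrAt C C' t ω :=
  fun ω ω' h0 hk => Finset.sum_congr rfl fun t ht =>
    observedBy_llrAt C C' t ω ω' h0 fun k hk' => hk k (by have := Finset.mem_range.1 ht; omega)

/-- Where `C` charges `x` this is an equality; it can be strict where only `C'` does. -/
theorem predictLaw_mul_exp_neg_le {C C' : ArmsConfig K S} (hac : Dominated C C')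
    {b : (Fin K → ℕ) × (Fin K → S)} {a : Fin K} (hb : 1 ≤ b.1 a) (x : S) :
    predictLaw C b a x * ENNReal.ofReal (Real.exp (-stepLlr C C' b a x)) ≤ predictLaw C' b a x := by
  by_cases hp : predictLaw C b a x = 0
  · simp [hp]
  have hq : predictLaw C' b a x ≠ 0 := fun h => hp (hac a _ _ x hb h)
  have hp' : 0 < (predictLaw C b a x).toReal :=
    ENNReal.toReal_pos hp (PMF.apply_ne_top _ _)
  have hq' : 0 < (predictLaw C' b a x).toReal :=
    ENNReal.toReal_pos hq (PMF.apply_ne_top _ _)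
  rw [stepLlr, ← Real.log_inv, Real.exp_log (by positivity), inv_div]
  nth_rw 1 [← ENNReal.ofReal_toReal (PMF.apply_ne_top (predictLaw C b a) x)]
  rw [← ENNReal.ofReal_mul hp'.le, mul_div_cancel₀ _ hp'.ne',
    ENNReal.ofReal_toReal (PMF.apply_ne_top _ _)]

variable [MeasurableSpace S] [DiscreteMeasurableSpace S]
variable (η : Set.Ioc (0 : ℝ) 1) (φ : PMF S) (π : Policy K S)

/-- The laws at time `0` coincide and the sampling probabilities depend only on the observations, so
both cancel from the likelihood ratio. Only the predictive laws of the observed states contribute.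
-/
theorem lintegral_mul_exp_neg_llr_le {C C' : ArmsConfig K S} (hac : Dominated C C') (n : ℕ)
    {F : (ℕ → Step K S) → ℝ≥0∞} (hF : ObservedBy n F) :
    ∫⁻ ω, F ω * ENNReal.ofReal (Real.exp (-∑ t ∈ Finset.range n, llrAt C C' t ω))
      ∂law η φ π C ≤ ∫⁻ ω, F ω ∂law η φ π C' := by
  induction n generalizing F with
  | zero =>
    simp only [Finset.range_zero, Finset.sum_empty, neg_zero, Real.exp_zero, ENNReal.ofReal_one,
      mul_one]
    exact (lintegral_eq_of_dependsOn_zero η φ π C C' hF.dependsOn).le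
  | succ n ih =>
    let R (C : ArmsConfig K S) (ω : ℕ → Step K S) : ℝ≥0∞ := ∑ p, armsLaw η π n (obs n ω) p *
      ∑ x, predictLaw C (belief ω n) p.2 x * F (Function.update ω (n + 1) (p, fun _ => x))
    have hR : ObservedBy n (R C') := fun ω ω' h0 hk => by
      simp only [R]
      rw [obs_congr hk, belief_congr h0 hk]
      exact Finset.sum_congr rfl fun p _ => congrArg _ <| Finset.sum_congr rfl fun x _ =>
        congrArg _ (hF.update_succ _ ω ω' h0 hk)
    calc _ ≤ ∫⁻ ω, R C' ω *
          ENNReal.ofReal (Real.exp (-∑ t ∈ Finset.range n, llrAt C C' t ω)) ∂law η φ π C := by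
          rw [lintegral_observed_step η φ π C (n := n)]
          · refine lintegral_mono fun ω => ?_
            simp only [R]
            rw [Finset.sum_mul]
            refine Finset.sum_le_sum fun p _ => ?_
            rw [mul_assoc]
            gcongr
            rw [Finset.sum_mul]
            refine Finset.sum_le_sum fun x _ => ?_
            have h1 : ∑ t ∈ Finset.range n,
                llrAt C C' t (Function.update ω (n + 1) (p, fun _ => x)) =
                ∑ t ∈ Finset.range n, llrAt C C' t ω := (observedBy_sum_llrAt C C' n).update _ _
            rw [Finset.sum_range_succ, llrAt_update, h1, neg_add, Real.exp_add,
              ENNReal.ofReal_mul (Real.exp_nonneg _)]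
            have h2 := predictLaw_mul_exp_neg_le hac (one_le_belief ω n p.2) x
            calc _ = (predictLaw C (belief ω n) p.2 x *
                    ENNReal.ofReal (Real.exp (-stepLlr C C' (belief ω n) p.2 x))) *
                  (F (Function.update ω (n + 1) (p, fun _ => x)) *
                    ENNReal.ofReal (Real.exp (-∑ t ∈ Finset.range n, llrAt C C' t ω))) := by
                    simp only [predictLaw]; ring
              _ ≤ predictLaw C' (belief ω n) p.2 x *
                  (F (Function.update ω (n + 1) (p, fun _ => x)) *
                    ENNReal.ofReal (Real.exp (-∑ t ∈ Finset.range n, llrAt C C' t ω))) := by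
                    gcongr
              _ = _ := by ring
          · intro ω ω' h0 hk
            dsimp only
            rw [hF ω ω' h0 hk, show ∑ t ∈ Finset.range (n + 1), llrAt C C' t ω = _ from
              observedBy_sum_llrAt C C' (n + 1) ω ω' h0 hk]
      _ ≤ ∫⁻ ω, R C' ω ∂law η φ π C' := ih hR
      _ = _ := (lintegral_observed_step η φ π C' hF).symm

end ChangeOfMeasure

/-! ### Relative entropy on a finite set -/

section Divergence

variable {S : Type*} [Fintype S] [MeasurableSpace S] [DiscreteMeasurableSpace S]

theorem toMeasure_real_singleton (p : PMF S) (x : S) : p.toMeasure.real {x} = (p x).toReal := by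
  rw [Measure.real, PMF.toMeasure_apply_singleton _ _ (measurableSet_singleton x)]

theorem toMeasure_absolutelyContinuous_iff (p q : PMF S) :
    p.toMeasure ≪ q.toMeasure ↔ ∀ x, q x = 0 → p x = 0 := by
  constructor
  · intro h x hx
    rw [← PMF.toMeasure_apply_singleton p x (measurableSet_singleton x)]
    exact h (by rw [PMF.toMeasure_apply_singleton _ _ (measurableSet_singleton x), hx])
  · intro h
    refine Measure.AbsolutelyContinuous.mk fun s hs h0 => ?_
    rw [PMF.toMeasure_apply_eq_zero_iff _ hs] at h0 ⊢
    refine h0.mono_left fun x hx => ?_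
    rw [PMF.mem_support_iff] at hx ⊢
    exact fun hq => hx (h x hq)

theorem sum_mul_llr (p q : PMF S) (h : ∀ x, q x = 0 → p x = 0) :
    ∫ x, llr p.toMeasure q.toMeasure x ∂p.toMeasure =
      ∑ x, (p x).toReal * Real.log ((p x).toReal / (q x).toReal) := by
  have hac := (toMeasure_absolutelyContinuous_iff p q).2 h
  rw [integral_fintype .of_finite]
  refine Finset.sum_congr rfl fun x _ => ?_
  rw [toMeasure_real_singleton, smul_eq_mul]
  by_cases hp : p x = 0
  · simp [hp]
  have hq : q x ≠ 0 := fun hq => hp (h x hq)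
  have h1 : p.toMeasure.rnDeriv q.toMeasure x * q x = p x := by
    have h2 := congrArg (fun m : Measure S => m {x}) (Measure.withDensity_rnDeriv_eq _ _ hac)
    simp only [withDensity_apply _ (measurableSet_singleton x), lintegral_singleton,
      PMF.toMeasure_apply_singleton _ _ (measurableSet_singleton x)] at h2
    exact h2
  have hq' : (q x).toReal ≠ 0 := (ENNReal.toReal_pos hq (PMF.apply_ne_top _ _)).ne'
  rw [llr, ← h1, ENNReal.toReal_mul, mul_div_cancel_right₀ _ hq']

theorem klDiv_toMeasure (p q : PMF S) (h : ∀ x, q x = 0 → p x = 0) :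
    InformationTheory.klDiv p.toMeasure q.toMeasure =
      ENNReal.ofReal (∑ x, (p x).toReal * Real.log ((p x).toReal / (q x).toReal)) := by
  rw [InformationTheory.klDiv_of_ac_of_integrable
    ((toMeasure_absolutelyContinuous_iff p q).2 h) .of_finite, sum_mul_llr p q h]
  simp

theorem sum_mul_log_div_nonneg (p q : PMF S) (h : ∀ x, q x = 0 → p x = 0) :
    0 ≤ ∑ x, (p x).toReal * Real.log ((p x).toReal / (q x).toReal) := by
  have := InformationTheory.integral_llr_add_sub_measure_univ_nonneg
    ((toMeasure_absolutelyContinuous_iff p q).2 h) .of_finite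
  rw [sum_mul_llr p q h] at this
  simpa using this

theorem klDiv_toMeasure_eq_top_iff (p q : PMF S) :
    InformationTheory.klDiv p.toMeasure q.toMeasure = ∞ ↔ ∃ x, q x = 0 ∧ p x ≠ 0 := by
  by_cases h : ∀ x, q x = 0 → p x = 0
  · rw [klDiv_toMeasure p q h]
    simp only [ENNReal.ofReal_ne_top, false_iff]
    push Not
    exact h
  · rw [InformationTheory.klDiv_of_not_ac (by rwa [toMeasure_absolutelyContinuous_iff])]
    push Not at h
    simpa using h

/-- Every ratio `p x / q x` is at most `1 / δ`. -/
theorem klDiv_toMeasure_le_log (p q : PMF S) {δ : ℝ} (hδ : 0 < δ) (hδ' : ∀ x, δ ≤ (q x).toReal) :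
    InformationTheory.klDiv p.toMeasure q.toMeasure ≤ ENNReal.ofReal (-Real.log δ) := by
  have h : ∀ x, q x = 0 → p x = 0 := fun x hx => by
    have := hδ' x
    rw [hx, ENNReal.toReal_zero] at this
    linarith
  rw [klDiv_toMeasure p q h]
  refine ENNReal.ofReal_le_ofReal ?_
  calc _ ≤ ∑ x, (p x).toReal * (-Real.log δ) := by
        refine Finset.sum_le_sum fun x _ => ?_
        by_cases hp : p x = 0
        · simp [hp]
        have hp' : 0 < (p x).toReal := ENNReal.toReal_pos hp (PMF.apply_ne_top _ _)
        have hp1 : (p x).toReal ≤ 1 := by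
          simpa using ENNReal.toReal_mono ENNReal.one_ne_top (p.coe_le_one x)
        refine mul_le_mul_of_nonneg_left ?_ hp'.le
        rw [← Real.log_inv]
        refine Real.log_le_log (div_pos hp' (hδ.trans_le (hδ' x))) ?_
        rw [inv_eq_one_div]
        exact div_le_div₀ zero_le_one hp1 hδ (hδ' x)
    _ = -Real.log δ := by rw [← Finset.sum_mul, PMF.sum_toReal, one_mul]

end Divergence

/-! ### Stopping and declaring as events of the observed history -/

section Stopping

variable {K : ℕ} {S : Type*}

/-- The policy has not stopped by time `n`. -/
def Alive (π : Policy K S) (n : ℕ) (ω : ℕ → Step K S) : Prop :=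
  ∀ m ≤ n, K ≤ m + 1 → ¬(decision π ω m).isRight

/-- The policy stops at time `n`. -/
def StopsAt (π : Policy K S) (n : ℕ) (ω : ℕ → Step K S) : Prop :=
  (∀ m < n, K ≤ m + 1 → ¬(decision π ω m).isRight) ∧ K ≤ n + 1 ∧ (decision π ω n).isRight

theorem decision_congr (π : Policy K S) {n : ℕ} {ω ω' : ℕ → Step K S}
    (hk : ∀ k ≤ n, (ω k).observe = (ω' k).observe) : decision π ω n = decision π ω' n :=
  congrArg (π n) (obs_congr hk)

theorem observedBy_alive (π : Policy K S) (n : ℕ) : ObservedBy n (Alive π n) :=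
  fun ω ω' _ hk => propext <| forall₂_congr fun m hm => by
    rw [decision_congr π fun k hk' => hk k (hk'.trans hm)]

theorem observedBy_stopsAt (π : Policy K S) (n : ℕ) : ObservedBy n (StopsAt π n) := by
  intro ω ω' _ hk
  unfold StopsAt
  rw [decision_congr π hk]
  refine congrArg (· ∧ _) (propext <| forall₂_congr fun m hm => ?_)
  rw [decision_congr π fun k hk' => hk k (hk'.trans hm.le)]

theorem Alive.mono {π : Policy K S} {m n : ℕ} (h : m ≤ n) {ω : ℕ → Step K S}
    (hn : Alive π n ω) : Alive π m ω := fun k hk => hn k (hk.trans h)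

theorem StopsAt.alive_iff {π : Policy K S} {n : ℕ} {ω : ℕ → Step K S} (h : StopsAt π n ω)
    (m : ℕ) : Alive π m ω ↔ m < n :=
  ⟨fun hm => not_le.1 fun hnm => hm n hnm h.2.1 h.2.2,
    fun hm k hk => h.1 k (hk.trans_lt hm)⟩

theorem StopsAt.eq {π : Policy K S} {m n : ℕ} {ω : ℕ → Step K S} (hm : StopsAt π m ω)
    (hn : StopsAt π n ω) : m = n := by
  have h1 : ¬ n < m := fun h => hm.1 n h hn.2.1 hn.2.2
  have h2 : ¬ m < n := fun h => hn.1 m h hm.2.1 hm.2.2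
  omega

theorem exists_stopsAt_of_not_alive {π : Policy K S} {n : ℕ} {ω : ℕ → Step K S}
    (h : ¬Alive π n ω) : ∃ m ≤ n, StopsAt π m ω := by
  classical
  unfold Alive at h
  push Not at h
  have hex : ∃ m, m ≤ n ∧ K ≤ m + 1 ∧ (decision π ω m).isRight := by
    obtain ⟨m, h1, h2, h3⟩ := h
    exact ⟨m, h1, h2, by simpa using h3⟩
  refine ⟨Nat.find hex, (Nat.find_spec hex).1, fun m hm hK hr => ?_, (Nat.find_spec hex).2⟩
  exact Nat.find_min hex hm ⟨hm.le.trans (Nat.find_spec hex).1, hK, hr⟩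

theorem lt_stopTime_iff (π : Policy K S) (n : ℕ) (ω : ℕ → Step K S) :
    (n : ℕ∞) < stopTime π ω ↔ Alive π n ω := by
  unfold stopTime Alive
  constructor
  · intro h m hm hK hr
    exact (h.trans_le (iInf₂_le m ⟨hK, hr⟩)).not_ge (by exact_mod_cast hm)
  · intro h
    refine (ENat.natCast_lt_natCast.2 n.lt_succ_self).trans_le (le_iInf₂ fun m hm => ?_)
    have : ¬ m ≤ n := fun h' => h m h' hm.1 hm.2
    exact_mod_cast (by omega : n + 1 ≤ m)

theorem StopsAt.stopTime_eq {π : Policy K S} {n : ℕ} {ω : ℕ → Step K S} (h : StopsAt π n ω) :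
    stopTime π ω = n := by
  refine le_antisymm (iInf₂_le n h.2) (le_iInf₂ fun m hm => ?_)
  have : ¬ m < n := fun h' => h.1 m h' hm.1 hm.2
  exact_mod_cast (by omega : n ≤ m)

/-- The policy stops by time `n` and declares the arm `h`. -/
def DeclaresBy (π : Policy K S) (h : Fin K) (n : ℕ) (ω : ℕ → Step K S) : Prop :=
  ∃ m ≤ n, StopsAt π m ω ∧ decision π ω m = Sum.inr h

theorem observedBy_declaresBy (π : Policy K S) (h : Fin K) (n : ℕ) :
    ObservedBy n (DeclaresBy π h n) := by
  intro ω ω' h0 hk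
  refine propext <| exists_congr fun m => and_congr_right fun hm => ?_
  have hk' : ∀ k ≤ m, (ω k).observe = (ω' k).observe := fun k h => hk k (h.trans hm)
  rw [observedBy_stopsAt π m ω ω' h0 hk', decision_congr π hk']

end Stopping

/-! ### The information an admissible policy has to collect -/

section Information

variable {K : ℕ} {S : Type*} [Fintype S] [DecidableEq S] [MeasurableSpace S]
  [DiscreteMeasurableSpace S]

/-- The relative entropy of the laws of the next observation of arm `a`. -/
noncomputable def predictDiv (C C' : ArmsConfig K S) (b : (Fin K → ℕ) × (Fin K → S))
    (a : Fin K) : ℝ≥0∞ :=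
  InformationTheory.klDiv (predictLaw C b a).toMeasure (predictLaw C' b a).toMeasure

variable (η : Set.Ioc (0 : ℝ) 1) (φ : PMF S) (π : Policy K S)

open Classical in
/-- Log-likelihood ratio of what is observed after time `0` and up to time `n` or stoppage. -/
noncomputable def stoppedLlr (C C' : ArmsConfig K S) (n : ℕ) (ω : ℕ → Step K S) : ℝ :=
  ∑ t ∈ Finset.range n, if Alive π t ω then llrAt C C' t ω else 0

theorem stoppedLlr_of_alive {π : Policy K S} {C C' : ArmsConfig K S} {n : ℕ} {ω : ℕ → Step K S}
    (h : Alive π n ω) : stoppedLlr π C C' n ω = ∑ t ∈ Finset.range n, llrAt C C' t ω :=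
  Finset.sum_congr rfl fun _ ht => if_pos (h.mono (Finset.mem_range.1 ht).le)

theorem stoppedLlr_of_stopsAt {π : Policy K S} {C C' : ArmsConfig K S} {m n : ℕ} (hmn : m ≤ n)
    {ω : ℕ → Step K S} (h : StopsAt π m ω) :
    stoppedLlr π C C' n ω = ∑ t ∈ Finset.range m, llrAt C C' t ω := by
  unfold stoppedLlr
  rw [← Finset.sum_subset (Finset.range_subset_range.2 hmn)]
  · exact Finset.sum_congr rfl fun t ht => if_pos ((h.alive_iff t).2 (Finset.mem_range.1 ht))
  · intro t _ ht
    exact if_neg fun h' => ht (Finset.mem_range.2 ((h.alive_iff t).1 h'))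

open Classical in
/-- The payoff `exp c` for declaring `h` by time `n`, and `1` otherwise, times a weight that is
evaluated at time `n` or stoppage. -/
noncomputable def stoppedPayoff (h : Fin K) (c : ℝ) (W : ℕ → (ℕ → Step K S) → ℝ≥0∞) (n : ℕ)
    (ω : ℕ → Step K S) : ℝ≥0∞ :=
  ∑ m ∈ Finset.range (n + 1), (if StopsAt π m ω then
      (if decision π ω m = Sum.inr h then ENNReal.ofReal (Real.exp c) else 1) else 0) * W m ω +
    (if Alive π n ω then 1 else 0) * W n ω

theorem stoppedPayoff_of_alive {π : Policy K S} {h : Fin K} {c : ℝ}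
    {W : ℕ → (ℕ → Step K S) → ℝ≥0∞} {n : ℕ} {ω : ℕ → Step K S} (hn : Alive π n ω) :
    stoppedPayoff π h c W n ω = W n ω := by
  unfold stoppedPayoff
  rw [Finset.sum_eq_zero, if_pos hn]
  · simp
  · intro m hm
    have : ¬StopsAt π m ω := fun hs => by
      have := (hs.alive_iff n).1 hn
      have := Finset.mem_range.1 hm
      omega
    simp [this]

open Classical in
theorem stoppedPayoff_of_stopsAt {π : Policy K S} {h : Fin K} {c : ℝ}
    {W : ℕ → (ℕ → Step K S) → ℝ≥0∞} {m n : ℕ} {ω : ℕ → Step K S} (hmn : m ≤ n)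
    (hm : StopsAt π m ω) : stoppedPayoff π h c W n ω =
      (if decision π ω m = Sum.inr h then ENNReal.ofReal (Real.exp c) else 1) * W m ω := by
  unfold stoppedPayoff
  have : ¬Alive π n ω := fun h' => by have := (hm.alive_iff n).1 h'; omega
  rw [Finset.sum_eq_single m, if_pos hm, if_neg this]
  · simp
  · intro k _ hk
    have : ¬StopsAt π k ω := fun h' => hk (h'.eq hm)
    simp [this]
  · intro h'
    exact absurd (Finset.mem_range.2 (by omega)) h'

theorem observedBy_stoppedPayoff (h : Fin K) (c : ℝ) {W : ℕ → (ℕ → Step K S) → ℝ≥0∞}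
    (hW : ∀ n, ObservedBy n (W n)) (n : ℕ) : ObservedBy n (stoppedPayoff π h c W n) := by
  intro ω ω' h0 hk
  unfold stoppedPayoff
  rw [observedBy_alive π n ω ω' h0 hk, hW n ω ω' h0 hk]
  congr 1
  refine Finset.sum_congr rfl fun m hm => ?_
  have hk' : ∀ k ≤ m, (ω k).observe = (ω' k).observe :=
    fun k h => hk k (by have := Finset.mem_range.1 hm; omega)
  rw [observedBy_stopsAt π m ω ω' h0 hk', decision_congr π hk', hW m ω ω' h0 hk']

/-- The change of measure at a bounded stopping time: split according to its value `m` and use the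
fixed-time version on each piece. -/
theorem lintegral_stoppedPayoff_le {C C' : ArmsConfig K S} (hac : Dominated C C') (h : Fin K)
    (c : ℝ) (n : ℕ) :
    ∫⁻ ω, stoppedPayoff π h c (fun n ω => ENNReal.ofReal
        (Real.exp (-∑ t ∈ Finset.range n, llrAt C C' t ω))) n ω ∂law η φ π C ≤
      ∫⁻ ω, stoppedPayoff π h c (fun _ _ => 1) n ω ∂law η φ π C' := by
  classical
  have hW (n : ℕ) : ObservedBy n fun ω : ℕ → Step K S => ENNReal.ofReal
      (Real.exp (-∑ t ∈ Finset.range n, llrAt C C' t ω)) := fun ω ω' h0 hk => by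
    dsimp only
    rw [show ∑ t ∈ Finset.range n, llrAt C C' t ω = _ from
      observedBy_sum_llrAt C C' n ω ω' h0 hk]
  have hs (m : ℕ) : ObservedBy m fun ω => if StopsAt π m ω then
      (if decision π ω m = Sum.inr h then ENNReal.ofReal (Real.exp c) else 1) else 0 :=
    fun ω ω' h0 hk => by
      dsimp only
      rw [observedBy_stopsAt π m ω ω' h0 hk, decision_congr π hk]
  have ha : ObservedBy n fun ω => if Alive π n ω then (1 : ℝ≥0∞) else 0 :=
    fun ω ω' h0 hk => by
      dsimp only
      rw [observedBy_alive π n ω ω' h0 hk]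
  have hms (m : ℕ) := measurable_of_dependsOn (hs m).dependsOn
  have hma := measurable_of_dependsOn ha.dependsOn
  have hmW (m : ℕ) := measurable_of_dependsOn (hW m).dependsOn
  have e (P : Measure (ℕ → Step K S)) (W : ℕ → (ℕ → Step K S) → ℝ≥0∞)
      (hmW : ∀ m, Measurable (W m)) : ∫⁻ ω, stoppedPayoff π h c W n ω ∂P =
      ∑ m ∈ Finset.range (n + 1), ∫⁻ ω, (if StopsAt π m ω then
        (if decision π ω m = Sum.inr h then ENNReal.ofReal (Real.exp c) else 1) else 0) *
          W m ω ∂P + ∫⁻ ω, (if Alive π n ω then 1 else 0) * W n ω ∂P := by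
    have h1 := lintegral_finsetSum (μ := P) (Finset.range (n + 1))
      fun m _ => (hms m).mul (hmW m)
    exact (lintegral_add_right _ (hma.mul (hmW n))).trans (congrArg (· + _) h1)
  rw [e _ _ hmW, e _ _ fun _ => measurable_const]
  simp only [mul_one]
  exact add_le_add (Finset.sum_le_sum fun m _ => lintegral_mul_exp_neg_llr_le η φ π hac m (hs m))
    (lintegral_mul_exp_neg_llr_le η φ π hac n ha)

/-- The tangent to `exp` at `log 2`. It turns an exponential moment of at most `2` into a mean of at
most `log 2`, as Jensen's inequality would. -/
theorem le_half_exp (x : ℝ) : x ≤ Real.exp x / 2 - 1 + Real.log 2 := by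
  have := Real.add_one_le_exp (x - Real.log 2)
  rw [Real.exp_sub, Real.exp_log two_pos] at this
  linarith

open Classical in
-- The weighted payoff is exactly the exponential of the left side, so this is `le_half_exp`.
theorem reward_sub_stoppedLlr_le (C C' : ArmsConfig K S) (h : Fin K) (c : ℝ) (n : ℕ)
    (ω : ℕ → Step K S) :
    (if DeclaresBy π h n ω then c else 0) - stoppedLlr π C C' n ω ≤
      (stoppedPayoff π h c (fun n ω => ENNReal.ofReal
        (Real.exp (-∑ t ∈ Finset.range n, llrAt C C' t ω))) n ω).toReal / 2 - 1 + Real.log 2 := by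
  by_cases hn : Alive π n ω
  · have : ¬DeclaresBy π h n ω := fun ⟨m, hm, hs, _⟩ => by
      have := (hs.alive_iff n).1 hn
      omega
    rw [stoppedPayoff_of_alive hn, stoppedLlr_of_alive hn, if_neg this,
      ENNReal.toReal_ofReal (Real.exp_nonneg _), zero_sub]
    exact le_half_exp _
  · obtain ⟨m, hm, hs⟩ := exists_stopsAt_of_not_alive hn
    have hd : DeclaresBy π h n ω ↔ decision π ω m = Sum.inr h := by
      refine ⟨fun ⟨k, _, hs', hd⟩ => ?_, fun hd => ⟨m, hm, hs, hd⟩⟩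
      rwa [← hs'.eq hs]
    rw [stoppedPayoff_of_stopsAt hm hs, stoppedLlr_of_stopsAt hm hs, ENNReal.toReal_mul,
      ENNReal.toReal_ofReal (Real.exp_nonneg _)]
    by_cases hd' : decision π ω m = Sum.inr h
    · rw [if_pos (hd.2 hd'), if_pos hd', ENNReal.toReal_ofReal (Real.exp_nonneg _),
        ← Real.exp_add, ← sub_eq_add_neg]
      exact le_half_exp _
    · rw [if_neg (fun h => hd' (hd.1 h)), if_neg hd', ENNReal.toReal_one, one_mul, zero_sub]
      exact le_half_exp _

theorem stoppedPayoff_one_le (h : Fin K) (c : ℝ) (h' : Fin K) (hh : h ≠ h') (n : ℕ)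
    (ω : ℕ → Step K S) : stoppedPayoff π h c (fun _ _ => 1) n ω ≤
      1 + (wrongDecision π h').indicator (fun _ => ENNReal.ofReal (Real.exp c)) ω := by
  by_cases hn : Alive π n ω
  · rw [stoppedPayoff_of_alive hn]
    exact le_self_add
  · obtain ⟨m, hm, hs⟩ := exists_stopsAt_of_not_alive hn
    rw [stoppedPayoff_of_stopsAt hm hs, mul_one]
    split_ifs with hd
    · rw [Set.indicator_of_mem (show ω ∈ wrongDecision π h' from
        ⟨m, hs.stopTime_eq, h, hd, hh⟩)]
      exact le_add_self
    · exact le_self_add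

/-- Under `C'` the declaration `h` is wrong, hence has probability at most `ε`, which balances its
payoff `1 / ε`. The bound is `1 + (1 / ε) * ε`. -/
theorem lintegral_stoppedPayoff_one_le {ε : ℝ} (hε : 0 < ε) (hπ : π ∈ admissible η φ ε)
    (C' : ArmsConfig K S) (h : Fin K) (hh : h ≠ C'.h) (n : ℕ) :
    ∫⁻ ω, stoppedPayoff π h (Real.log (1 / ε)) (fun _ _ => 1) n ω ∂law η φ π C' ≤ 2 := by
  calc _ ≤ ∫⁻ ω, (1 + (wrongDecision π C'.h).indicator
          (fun _ => ENNReal.ofReal (Real.exp (Real.log (1 / ε)))) ω) ∂law η φ π C' :=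
        lintegral_mono fun ω => stoppedPayoff_one_le π h _ C'.h hh n ω
    _ = 1 + ∫⁻ ω, (wrongDecision π C'.h).indicator
          (fun _ => ENNReal.ofReal (Real.exp (Real.log (1 / ε)))) ω ∂law η φ π C' := by
        rw [lintegral_add_left measurable_const]
        simp
    _ ≤ 1 + ENNReal.ofReal (1 / ε) * ENNReal.ofReal ε := by
        gcongr
        refine (lintegral_indicator_const_le _ _).trans ?_
        rw [Real.exp_log (by positivity)]
        gcongr
        exact hπ C'
    _ = 2 := by
        rw [← ENNReal.ofReal_mul (by positivity), one_div, inv_mul_cancel₀ hε.ne',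
          ENNReal.ofReal_one]
        norm_num

theorem observedBy_stoppedLlr (C C' : ArmsConfig K S) (n : ℕ) :
    ObservedBy n (stoppedLlr π C C' n) := by
  intro ω ω' h0 hk
  refine Finset.sum_congr rfl fun t ht => ?_
  have ht' := Finset.mem_range.1 ht
  rw [observedBy_alive π t ω ω' h0 fun k hk' => hk k (by omega),
    observedBy_llrAt C C' t ω ω' h0 fun k hk' => hk k (by omega)]

/-- Reward minus log-likelihood ratio has exponential moment at most `2` under `C`, by the change of
measure, so its mean is at most `log 2`. -/
theorem log_mul_measure_declaresBy_le {C C' : ArmsConfig K S} (hac : Dominated C C')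
    (hh : C.h ≠ C'.h) {ε : ℝ} (hε : 0 < ε) (hπ : π ∈ admissible η φ ε) (n : ℕ) :
    Real.log (1 / ε) * (law η φ π C).real {ω | DeclaresBy π C.h n ω} - Real.log 2 ≤
      ∫ ω, stoppedLlr π C C' n ω ∂law η φ π C := by
  classical
  set P := law η φ π C
  set Y := stoppedPayoff π C.h (Real.log (1 / ε)) (fun n ω => ENNReal.ofReal
        (Real.exp (-∑ t ∈ Finset.range n, llrAt C C' t ω))) n
  have hY : ObservedBy n Y := observedBy_stoppedPayoff π _ _ (fun n ω ω' h0 hk => by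
    rw [show ∑ t ∈ Finset.range n, llrAt C C' t ω = _ from
      observedBy_sum_llrAt C C' n ω ω' h0 hk]) n
  have hY2 : ∫⁻ ω, Y ω ∂P ≤ 2 := (lintegral_stoppedPayoff_le η φ π hac C.h _ n).trans
    (lintegral_stoppedPayoff_one_le η φ π hε hπ C' C.h hh n)
  have hYm := measurable_of_dependsOn hY.dependsOn
  have hYi : ∫ ω, (Y ω).toReal ∂P ≤ 2 := by
    rw [integral_toReal hYm.aemeasurable (ae_lt_top hYm (hY2.trans_lt (by simp)).ne)]
    exact ENNReal.toReal_le_of_le_ofReal two_pos.le (by simpa using hY2)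
  have hD : ObservedBy n fun ω => if DeclaresBy π C.h n ω then Real.log (1 / ε) else 0 :=
    fun ω ω' h0 hk => by
      dsimp only
      rw [observedBy_declaresBy π C.h n ω ω' h0 hk]
  have hYr : ObservedBy n fun ω => (Y ω).toReal := fun ω ω' h0 hk =>
    congrArg ENNReal.toReal (hY ω ω' h0 hk)
  have hDi := integrable_of_dependsOn η φ π C hD.dependsOn
  have hLi := integrable_of_dependsOn η φ π C (observedBy_stoppedLlr π C C' n).dependsOn
  have hYri := integrable_of_dependsOn η φ π C hYr.dependsOn
  have hDe : ∫ ω, (if DeclaresBy π C.h n ω then Real.log (1 / ε) else 0) ∂P =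
      Real.log (1 / ε) * P.real {ω | DeclaresBy π C.h n ω} := by
    have hm : MeasurableSet {ω | DeclaresBy π C.h n ω} :=
      measurableSet_setOfPred.2 (measurable_of_dependsOn (observedBy_declaresBy π C.h n).dependsOn)
    have : (fun ω => if DeclaresBy π C.h n ω then Real.log (1 / ε) else 0) =
        {ω | DeclaresBy π C.h n ω}.indicator fun _ => Real.log (1 / ε) := by
      funext ω; simp [Set.indicator]
    rw [this, integral_indicator_const _ hm, smul_eq_mul, mul_comm]
  have key : ∫ ω, ((if DeclaresBy π C.h n ω then Real.log (1 / ε) else 0) -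
      stoppedLlr π C C' n ω) ∂P ≤ ∫ ω, ((Y ω).toReal / 2 + (- 1 + Real.log 2)) ∂P :=
    integral_mono (hDi.sub hLi) ((hYri.div_const 2).add (integrable_const _)) fun ω => by
      have := reward_sub_stoppedLlr_le π C C' C.h (Real.log (1 / ε)) n ω
      simp only [Y]
      linarith
  rw [integral_sub hDi hLi, integral_add (hYri.div_const 2) (integrable_const _), hDe,
    integral_div] at key
  simp only [integral_const, probReal_univ, one_smul] at key
  linarith

open Classical in
-- The chain rule for relative entropy: conditionally on the past, the mean of one increment is the
-- divergence of the predictive laws, averaged over the sampled arm.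
theorem ofReal_integral_llrAt {C C' : ArmsConfig K S} (hac : Dominated C C') (t : ℕ) :
    ENNReal.ofReal (∫ ω, (if Alive π t ω then llrAt C C' t ω else 0) ∂law η φ π C) =
      ∫⁻ ω, (if Alive π t ω then ∑ p, armsLaw η π t (obs t ω) p *
        predictDiv C C' (belief ω t) p.2 else 0) ∂law η φ π C := by
  have hF : ObservedBy (t + 1) fun ω => if Alive π t ω then llrAt C C' t ω else 0 :=
    fun ω ω' h0 hk => by
      dsimp only
      rw [observedBy_alive π t ω ω' h0 fun k hk' => hk k (by omega),
        observedBy_llrAt C C' t ω ω' h0 hk]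
  have hM (ω : ℕ → Step K S) :
      nextMean η π C t (fun ω => if Alive π t ω then llrAt C C' t ω else 0) ω =
        if Alive π t ω then ∑ p, (armsLaw η π t (obs t ω) p).toReal *
          ∑ x, (predictLaw C (belief ω t) p.2 x).toReal *
            stepLlr C C' (belief ω t) p.2 x else 0 := by
    unfold nextMean
    simp only [llrAt_update, (observedBy_alive π t).update]
    split_ifs
    · rfl
    · simp
  have hkl (ω : ℕ → Step K S) (a : Fin K) : ∀ x, predictLaw C' (belief ω t) a x = 0 →
      predictLaw C (belief ω t) a x = 0 := fun x => hac _ _ _ _ (one_le_belief ω t a)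
  have hpos (ω : ℕ → Step K S) (p : Fin K × Fin K) :
      0 ≤ (armsLaw η π t (obs t ω) p).toReal * ∑ x, (predictLaw C (belief ω t) p.2 x).toReal *
            stepLlr C C' (belief ω t) p.2 x :=
    mul_nonneg ENNReal.toReal_nonneg (sum_mul_log_div_nonneg _ _ (hkl ω p.2))
  rw [integral_eq_integral_nextMean η φ π C hF,
    ofReal_integral_eq_lintegral_ofReal
      (integrable_of_dependsOn η φ π C (observedBy_nextMean η π C hF).dependsOn)]
  · refine lintegral_congr fun ω => ?_
    rw [hM]
    split_ifs
    · rw [ENNReal.ofReal_sum_of_nonneg fun p _ => hpos ω p]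
      refine Finset.sum_congr rfl fun p _ => ?_
      rw [ENNReal.ofReal_mul ENNReal.toReal_nonneg, ENNReal.ofReal_toReal (PMF.apply_ne_top _ _),
        predictDiv, klDiv_toMeasure _ _ (hkl ω p.2)]
      rfl
    · simp
  · refine ae_of_all _ fun ω => ?_
    simp only [hM, Pi.zero_apply]
    split_ifs
    · exact Finset.sum_nonneg fun p _ => hpos ω p
    · exact le_rfl

open Classical in
theorem ofReal_log_mul_measure_declaresBy_le {C C' : ArmsConfig K S} (hac : Dominated C C')
    (hh : C.h ≠ C'.h) {ε : ℝ} (hε : 0 < ε) (hπ : π ∈ admissible η φ ε) (n : ℕ) :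
    ENNReal.ofReal (Real.log (1 / ε) * (law η φ π C).real {ω | DeclaresBy π C.h n ω} -
      Real.log 2) ≤ ∑ t ∈ Finset.range n, ∫⁻ ω, (if Alive π t ω then
        ∑ p, armsLaw η π t (obs t ω) p * predictDiv C C' (belief ω t) p.2 else 0)
          ∂law η φ π C := by
  refine (ENNReal.ofReal_le_ofReal
    (log_mul_measure_declaresBy_le η φ π hac hh hε hπ n)).trans ?_
  unfold stoppedLlr
  rw [integral_finsetSum]
  · simp only [← ofReal_integral_llrAt η φ π hac]
    exact Finset.le_sum_of_subadditive _ ENNReal.ofReal_zero.le (fun _ _ => ENNReal.ofReal_add_le) _ _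
  · intro t _
    have hF : ObservedBy (t + 1) fun ω => if Alive π t ω then llrAt C C' t ω else 0 :=
      fun ω ω' h0 hk => by
        dsimp only
        rw [observedBy_alive π t ω ω' h0 fun k hk' => hk k (by omega),
          observedBy_llrAt C C' t ω ω' h0 hk]
    exact integrable_of_dependsOn η φ π C hF.dependsOn

end Information

/-! ### From beliefs to the controlled chain of delays -/

section DelayStates

variable {K : ℕ} {S : Type*}

@[ext]
theorem DelayState.ext {s t : DelayState K S} (hd : s.d = t.d) (hi : s.i = t.i) : s = t := by
  cases s; cases t; congr

instance [Countable S] : Countable (DelayState K S) :=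
  Function.Injective.countable (f := fun s : DelayState K S => (s.d, s.i)) fun _ _ h =>
    DelayState.ext (congrArg Prod.fst h) (congrArg Prod.snd h)

/-- The state of delays and last observed states after arm `a` has been observed in state `x`. -/
def DelayState.refresh (s : DelayState K S) (a : Fin K) (x : S) : DelayState K S where
  d := (OddArm.refresh (s.d, s.i) a x).1
  i := (OddArm.refresh (s.d, s.i) a x).2
  d_pos c := by simp only [OddArm.refresh]; split_ifs <;> omega
  d_injective c c' h := by
    have h1 := s.d_pos c
    have h2 := s.d_pos c'
    simp only [OddArm.refresh] at h
    split_ifs at h with h3 h4 h4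
    · rw [h3, h4]
    · omega
    · omega
    · exact s.d_injective (by omega)
  exists_d_eq_one := ⟨a, by simp [OddArm.refresh]⟩

/-- In the initial round arm `a` is observed at time `a`; until then it counts as last observed at
time `0`. -/
theorem belief_delay_of_lt (ω : ℕ → Step K S) {n : ℕ} (hn : n < K) (a : Fin K) :
    (belief ω n).1 a = if (a : ℕ) ≤ n then n - a + 1 else n + 1 := by
  induction n with
  | zero => simp only [belief]; split_ifs <;> omega
  | succ n ih =>
    have ih := ih (by omega)
    simp only [belief, refresh, nextArm, dif_pos hn, ih]
    by_cases ha : a = ⟨n + 1, hn⟩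
    · simp [ha]
    · have : (a : ℕ) ≠ n + 1 := fun h => ha (Fin.ext h)
      rw [if_neg ha]
      split_ifs <;> omega

/-- At the end of the initial round the delays are `K, K - 1, …, 1`, hence distinct, and every
refresh preserves the constraints. Earlier, the unsampled arms share a delay. -/
theorem exists_delayState (ω : ℕ → Step K S) {n : ℕ} (hn : K ≤ n + 1) :
    ∃ s : DelayState K S, (s.d, s.i) = belief ω n := by
  have hK : 0 < K := Fin.pos (ω 0).1.1
  obtain ⟨j, rfl⟩ : ∃ j, n = K - 1 + j := ⟨n - (K - 1), by omega⟩
  induction j with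
  | zero =>
    have hd (a : Fin K) : (belief ω (K - 1 + 0)).1 a = K - a := by
      have := a.2
      rw [belief_delay_of_lt ω (by omega), if_pos (by omega)]
      omega
    refine ⟨⟨(belief ω (K - 1 + 0)).1, (belief ω (K - 1 + 0)).2, one_le_belief ω _,
      fun a b h => ?_, ⟨⟨K - 1, by omega⟩, ?_⟩⟩, rfl⟩
    · have := a.2
      have := b.2
      rw [hd, hd] at h
      exact Fin.ext (by omega)
    · rw [hd]
      simp only
      omega
  | succ j ih =>
    obtain ⟨s, hs⟩ := ih (by omega)
    refine ⟨s.refresh (nextArm (K - 1 + j) (ω (K - 1 + j + 1)).1) (ω (K - 1 + j + 1)).observe.2, ?_⟩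
    rw [← add_assoc, belief, ← hs]
    rfl

/-- The state of delays and last observed states at the `j`-th decision. -/
noncomputable def stateAt (ω : ℕ → Step K S) (j : ℕ) : DelayState K S :=
  (exists_delayState ω (n := K - 1 + j) (by omega)).choose

theorem stateAt_spec (ω : ℕ → Step K S) (j : ℕ) :
    ((stateAt ω j).d, (stateAt ω j).i) = belief ω (K - 1 + j) :=
  (exists_delayState ω (n := K - 1 + j) (by omega)).choose_spec

theorem stateAt_eq_iff (ω : ℕ → Step K S) (j : ℕ) (s : DelayState K S) :
    stateAt ω j = s ↔ belief ω (K - 1 + j) = (s.d, s.i) := by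
  rw [← stateAt_spec]
  exact ⟨fun h => by rw [h], fun h => DelayState.ext (congrArg Prod.fst h) (congrArg Prod.snd h)⟩

theorem observedBy_stateAt (j : ℕ) :
    ObservedBy (K - 1 + j) fun ω : ℕ → Step K S => stateAt ω j := by
  intro ω ω' h0 hk
  dsimp only
  rw [stateAt_eq_iff, stateAt_spec]
  exact belief_congr h0 hk

theorem stateAt_update (ω : ℕ → Step K S) (j : ℕ) (p : Fin K × Fin K) (x : S) :
    stateAt (Function.update ω (K - 1 + j + 1) (p, fun _ => x)) (j + 1) =
      (stateAt ω j).refresh p.2 x := by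
  rw [stateAt_eq_iff, ← add_assoc, belief_update, ← stateAt_spec, nextArm, dif_neg (by omega)]
  rfl

theorem stateAt_zero_delay_le (ω : ℕ → Step K S) (a : Fin K) : (stateAt ω 0).d a ≤ K := by
  have h := congrArg (fun b => b.1 a) (stateAt_spec ω 0)
  have ha := a.2
  dsimp only at h
  rw [h, belief_delay_of_lt ω (by omega)]
  split_ifs <;> omega

variable [Fintype S] [DecidableEq S]

/-- The mean of `f` at the next state when arm `b` is intended. -/
noncomputable def nextSum (η : Set.Ioc (0 : ℝ) 1) (C : ArmsConfig K S) (s : DelayState K S)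
    (b : Fin K) (f : DelayState K S → ℝ≥0∞) : ℝ≥0∞ :=
  ∑ a, tremble η b a * ∑ x, row (C.tpm a ^ s.d a) (s.i a) x * f (s.refresh a x)

theorem refresh_eq_iff (s s' : DelayState K S) (a : Fin K) (x : S) : s.refresh a x = s' ↔
    (s'.d a = 1 ∧ ∀ c, c ≠ a → s'.d c = s.d c + 1 ∧ s'.i c = s.i c) ∧ s'.i a = x := by
  constructor
  · rintro rfl
    refine ⟨⟨by simp [DelayState.refresh, refresh], fun c hc => ?_⟩,
      by simp [DelayState.refresh, refresh]⟩
    simp [DelayState.refresh, refresh, hc]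
  · rintro ⟨⟨h1, h2⟩, h3⟩
    refine DelayState.ext (funext fun c => ?_) (funext fun c => ?_)
    all_goals
      by_cases hc : c = a
      · subst hc; simp [DelayState.refresh, refresh, h1, h3]
      · simp [DelayState.refresh, refresh, hc, h2 c hc]

open Classical in
theorem nextSum_single (η : Set.Ioc (0 : ℝ) 1) (C : ArmsConfig K S) (s : DelayState K S)
    (b : Fin K) (s' : DelayState K S) :
    nextSum η C s b (fun t => if t = s' then 1 else 0) = transProb η C s b s' := by
  unfold nextSum transProb
  refine Finset.sum_congr rfl fun a _ => ?_
  simp only [refresh_eq_iff]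
  by_cases h : s'.d a = 1 ∧ ∀ c, c ≠ a → s'.d c = s.d c + 1 ∧ s'.i c = s.i c
  · simp only [if_pos h, and_iff_right h]
    simp
  · simp only [if_neg h, fun x => iff_false_intro fun h' : _ ∧ s'.i a = x => h h'.1]
    simp

theorem nextSum_one (η : Set.Ioc (0 : ℝ) 1) (C : ArmsConfig K S) (s : DelayState K S)
    (b : Fin K) : nextSum η C s b (fun _ => 1) = 1 := by
  simp [nextSum, PMF.sum_coe]

open Classical in
theorem tsum_transProb_mul (η : Set.Ioc (0 : ℝ) 1) (C : ArmsConfig K S) (s : DelayState K S)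
    (b : Fin K) (f : DelayState K S → ℝ≥0∞) :
    ∑' s', transProb η C s b s' * f s' = nextSum η C s b f := by
  simp only [← nextSum_single, nextSum, Finset.sum_mul, mul_assoc, Finset.mul_sum, ite_mul,
    one_mul, zero_mul]
  rw [Summable.tsum_finsetSum fun _ _ => ENNReal.summable]
  refine Finset.sum_congr rfl fun a _ => ?_
  rw [Summable.tsum_finsetSum fun _ _ => ENNReal.summable]
  refine Finset.sum_congr rfl fun x _ => ?_
  rw [ENNReal.tsum_mul_left, ENNReal.tsum_mul_left]
  congr 2
  rw [tsum_eq_single (s.refresh a x)]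
  · simp
  · intro t ht
    simp [ht.symm]

end DelayStates

/-! ### Expected visits before stoppage and their balance -/

section Occupation

variable {K : ℕ} {S : Type*}

/-- The law of the arm that the policy intends to sample next. -/
noncomputable def choice (π : Policy K S) (n : ℕ) (ω : ℕ → Step K S) : PMF (Fin K) :=
  Sum.elim id PMF.pure (decision π ω n)

theorem observedBy_choice (π : Policy K S) (n : ℕ) : ObservedBy n (choice π n) :=
  fun ω ω' _ hk => by unfold choice; rw [decision_congr π hk]

theorem sum_armsLaw_mul (η : Set.Ioc (0 : ℝ) 1) (π : Policy K S) {n : ℕ} (hn : K ≤ n + 1)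
    (ω : ℕ → Step K S) (g : Fin K → ℝ≥0∞) :
    ∑ p, armsLaw η π n (obs n ω) p * g p.2 =
      ∑ b, choice π n ω b * ∑ a, tremble η b a * g a := by
  have h (b a : Fin K) : armsLaw η π n (obs n ω) (b, a) = choice π n ω b * tremble η b a := by
    rw [armsLaw, dif_neg (by omega), PMF.bind_apply, tsum_fintype]
    change ∑ c, choice π n ω c * _ = _
    rw [Finset.sum_eq_single b]
    · rw [PMF.map_apply, tsum_fintype, Finset.sum_eq_single a]
      · simp
      · intro c _ hc; simp [hc.symm]
      · simp
    · intro c _ hc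
      rw [PMF.map_apply, tsum_fintype, Finset.sum_eq_zero, mul_zero]
      intro d _
      simp [hc.symm]
    · simp
  rw [Fintype.sum_prod_type]
  simp only [h, Finset.mul_sum, mul_assoc]

variable [Fintype S] [DecidableEq S] [MeasurableSpace S] [DiscreteMeasurableSpace S]
variable (η : Set.Ioc (0 : ℝ) 1) (φ : PMF S) (π : Policy K S) (C : ArmsConfig K S)

open Classical in
/-- The expected number of times, before stoppage, at which the state is `s` and the policy
intends to sample arm `b`. -/
noncomputable def visits (s : DelayState K S) (b : Fin K) : ℝ≥0∞ :=
  ∑' j, ∫⁻ ω, (if Alive π (K - 1 + j) ω ∧ stateAt ω j = s then choice π (K - 1 + j) ω b else 0)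
    ∂law η φ π C

open Classical in
theorem tsum_visits_mul (f : DelayState K S → Fin K → ℝ≥0∞) :
    ∑' s, ∑ b, visits η φ π C s b * f s b = ∑' j, ∫⁻ ω, (if Alive π (K - 1 + j) ω then
      ∑ b, choice π (K - 1 + j) ω b * f (stateAt ω j) b else 0) ∂law η φ π C := by
  have hm (j : ℕ) (s : DelayState K S) (b : Fin K) : Measurable fun ω =>
      if Alive π (K - 1 + j) ω ∧ stateAt ω j = s then choice π (K - 1 + j) ω b else 0 :=
    measurable_of_dependsOn (n := K - 1 + j) (ObservedBy.dependsOn fun ω ω' h0 hk => by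
      rw [observedBy_alive π _ ω ω' h0 hk, observedBy_choice π _ ω ω' h0 hk,
        show stateAt ω j = _ from observedBy_stateAt j ω ω' h0 hk])
  unfold visits
  simp only [← ENNReal.tsum_mul_right]
  simp only [← lintegral_mul_const _ (hm _ _ _)]
  have h1 (s : DelayState K S) : ∑ b, ∑' j, ∫⁻ ω,
      (if Alive π (K - 1 + j) ω ∧ stateAt ω j = s then choice π (K - 1 + j) ω b else 0) * f s b
        ∂law η φ π C = ∑' j, ∫⁻ ω, ∑ b,
      (if Alive π (K - 1 + j) ω ∧ stateAt ω j = s then choice π (K - 1 + j) ω b else 0) * f s b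
        ∂law η φ π C := by
    rw [← Summable.tsum_finsetSum fun _ _ => ENNReal.summable]
    refine tsum_congr fun j => ?_
    rw [lintegral_finsetSum _ fun b _ => (hm j s b).mul_const _]
  simp only [h1]
  rw [ENNReal.tsum_comm]
  refine tsum_congr fun j => ?_
  rw [← lintegral_tsum fun s =>
    (Finset.measurable_sum _ fun b _ => (hm j s b).mul_const _).aemeasurable]
  refine lintegral_congr fun ω => ?_
  rw [tsum_eq_single (stateAt ω j)]
  · split_ifs <;> simp_all
  · intro s hs
    simp [hs.symm]

open Classical in
theorem tsum_visits_mul_state (f : DelayState K S → ℝ≥0∞) :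
    ∑' s, (∑ b, visits η φ π C s b) * f s = ∑' j, ∫⁻ ω, (if Alive π (K - 1 + j) ω then
      f (stateAt ω j) else 0) ∂law η φ π C := by
  simp only [Finset.sum_mul]
  rw [tsum_visits_mul η φ π C fun s _ => f s]
  simp only [← Finset.sum_mul, PMF.sum_coe, one_mul]

open Classical in
-- The Markov property of the controlled chain. Survival is tested at the decision, not at the
-- resulting state, so the state in which the policy stops is included on the right.
theorem tsum_visits_mul_nextSum (f : DelayState K S → ℝ≥0∞) :
    ∑' s, ∑ b, visits η φ π C s b * nextSum η C s b f =
      ∑' j, ∫⁻ ω, (if Alive π (K - 1 + j) ω then f (stateAt ω (j + 1)) else 0)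
        ∂law η φ π C := by
  rw [tsum_visits_mul η φ π C fun s b => nextSum η C s b f]
  refine tsum_congr fun j => ?_
  have hF : ObservedBy (K - 1 + j + 1) fun ω => if Alive π (K - 1 + j) ω then
      f (stateAt ω (j + 1)) else 0 := fun ω ω' h0 hk => by
    dsimp only
    rw [observedBy_alive π _ ω ω' h0 fun k hk' => hk k (by omega),
      show stateAt ω (j + 1) = _ from observedBy_stateAt (j + 1) ω ω' h0 hk]
  rw [lintegral_observed_step η φ π C hF]
  refine lintegral_congr fun ω => ?_
  simp only [(observedBy_alive π _).update, stateAt_update, ← stateAt_spec]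
  split_ifs with h
  · rw [sum_armsLaw_mul η π (by omega) ω fun a => ∑ x,
      row (C.tpm a ^ (stateAt ω j).d a) ((stateAt ω j).i a) x * f ((stateAt ω j).refresh a x)]
    rfl
  · simp

/-- The expected number of decisions before stoppage. -/
noncomputable def totalVisits : ℝ≥0∞ := ∑' s, ∑ b, visits η φ π C s b

open Classical in
theorem totalVisits_eq : totalVisits η φ π C =
    ∑' j, ∫⁻ ω, (if Alive π (K - 1 + j) ω then 1 else 0) ∂law η φ π C := by
  simpa [totalVisits] using tsum_visits_mul_state η φ π C fun _ => 1

open Classical in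
theorem measurable_alive_indicator (n : ℕ) :
    Measurable fun ω : ℕ → Step K S => if Alive π n ω then (1 : ℝ≥0∞) else 0 :=
  measurable_of_dependsOn (n := n) (ObservedBy.dependsOn fun ω ω' h0 hk => by
      rw [observedBy_alive π _ ω ω' h0 hk])

/-- Each counted decision occurs at a distinct time strictly before stoppage. -/
theorem totalVisits_le : totalVisits η φ π C ≤ expectedStopTime η φ π C := by
  classical
  rw [totalVisits_eq, ← lintegral_tsum fun j => (measurable_alive_indicator π _).aemeasurable]
  refine lintegral_mono fun ω => ?_
  dsimp only
  rcases h : stopTime π ω with _ | n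
  · change _ ≤ ((⊤ : ℕ∞) : ℝ≥0∞)
    simp
  · change _ ≤ ((n : ℕ∞) : ℝ≥0∞)
    have h' : stopTime π ω = (n : ℕ∞) := h
    rw [tsum_eq_sum (s := Finset.range n)]
    · calc _ ≤ ∑ j ∈ Finset.range n, (1 : ℝ≥0∞) :=
            Finset.sum_le_sum fun j _ => by split_ifs <;> simp
        _ = _ := by simp
    · intro j hj
      rw [if_neg]
      rw [← lt_stopTime_iff, h']
      have : ¬ j < n := fun h => hj (Finset.mem_range.2 h)
      exact_mod_cast (by omega : ¬ K - 1 + j < n)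

open Classical in
theorem tsum_stopsAt_le (ω : ℕ → Step K S) (g : ℕ → ℕ) (hg : Function.Injective g) :
    ∑' j, (if StopsAt π (g j) ω then (1 : ℝ≥0∞) else 0) ≤ 1 := by
  by_cases h : ∃ j, StopsAt π (g j) ω
  · obtain ⟨j, hj⟩ := h
    rw [tsum_eq_single j]
    · split_ifs
      all_goals simp
    · intro k hk
      rw [if_neg fun h' => hk (hg (h'.eq hj))]
  · push Not at h
    simp [h]

/-- An arrival at `s'` is itself counted as a visit unless the policy stops there, and it stops at
most once. -/
theorem tsum_visits_mul_transProb_le (s' : DelayState K S) :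
    ∑' s, ∑ b, visits η φ π C s b * transProb η C s b s' ≤ ∑ b, visits η φ π C s' b + 1 := by
  classical
  have h1 := tsum_visits_mul_nextSum η φ π C fun t => if t = s' then 1 else 0
  simp only [nextSum_single] at h1
  have h2 : ∑ b, visits η φ π C s' b = ∑' j, ∫⁻ ω, (if Alive π (K - 1 + j) ω then
      (if stateAt ω j = s' then 1 else 0) else 0) ∂law η φ π C := by
    rw [← tsum_visits_mul_state η φ π C fun t => if t = s' then 1 else 0, tsum_eq_single s']
    · simp
    · intro t ht; simp [ht]
  have hm (j : ℕ) : Measurable fun ω : ℕ → Step K S =>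
      if StopsAt π (K - 1 + j + 1) ω then (1 : ℝ≥0∞) else 0 :=
    measurable_of_dependsOn (n := K - 1 + j + 1) (ObservedBy.dependsOn fun ω ω' h0 hk => by
      rw [observedBy_stopsAt π _ ω ω' h0 hk])
  rw [h1, h2]
  calc _ ≤ ∑' j, (∫⁻ ω, (if Alive π (K - 1 + (j + 1)) ω then
          (if stateAt ω (j + 1) = s' then 1 else 0) else 0) ∂law η φ π C +
          ∫⁻ ω, (if StopsAt π (K - 1 + j + 1) ω then 1 else 0) ∂law η φ π C) := by
        refine ENNReal.tsum_le_tsum fun j => ?_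
        rw [← lintegral_add_right _ (hm j)]
        refine lintegral_mono fun ω => ?_
        by_cases ha : Alive π (K - 1 + (j + 1)) ω
        · simp only [if_pos ha, if_pos (ha.mono (m := K - 1 + j) (by omega))]
          exact le_self_add
        · by_cases hs : Alive π (K - 1 + j) ω
          · obtain ⟨m, hm, hms⟩ := exists_stopsAt_of_not_alive ha
            have := (hms.alive_iff _).1 hs
            have hmj : m = K - 1 + j + 1 := by omega
            subst hmj
            simp only [if_pos hms]
            refine le_trans ?_ le_add_self
            split_ifs <;> simp
          · simp [hs]
    _ = ∑' j, ∫⁻ ω, (if Alive π (K - 1 + (j + 1)) ω then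
          (if stateAt ω (j + 1) = s' then 1 else 0) else 0) ∂law η φ π C +
          ∑' j, ∫⁻ ω, (if StopsAt π (K - 1 + j + 1) ω then 1 else 0) ∂law η φ π C :=
        ENNReal.tsum_add
    _ ≤ _ := by
        refine add_le_add ?_ ?_
        · exact ENNReal.tsum_comp_le_tsum_of_injective (add_left_injective 1)
            (fun j => ∫⁻ ω, (if Alive π (K - 1 + j) ω then
              (if stateAt ω j = s' then 1 else 0) else 0) ∂law η φ π C)
        · rw [← lintegral_tsum fun j => (hm j).aemeasurable]
          calc _ ≤ ∫⁻ ω, 1 ∂law η φ π C := lintegral_mono fun ω =>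
                tsum_stopsAt_le π ω (fun j => K - 1 + j + 1) fun i j h => by
                  dsimp only at h; omega
            _ = 1 := by simp

/-- Every visit but the first is the successor of an earlier visit; `c` accounts for the first. -/
theorem tsum_visits_mul_le {f : DelayState K S → ℝ≥0∞} {c : ℝ≥0∞}
    (hc : ∀ ω : ℕ → Step K S, f (stateAt ω 0) ≤ c) :
    ∑' s, (∑ b, visits η φ π C s b) * f s ≤
      c + ∑' s, ∑ b, visits η φ π C s b * nextSum η C s b f := by
  classical
  rw [tsum_visits_mul_state, tsum_visits_mul_nextSum, tsum_eq_zero_add' ENNReal.summable]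
  refine add_le_add ?_ (ENNReal.tsum_le_tsum fun j => lintegral_mono fun ω => ?_)
  · calc _ ≤ ∫⁻ ω, c ∂law η φ π C := lintegral_mono fun ω => by
          split_ifs
          · exact hc ω
          · exact zero_le
      _ = c := by simp
  · by_cases ha : Alive π (K - 1 + (j + 1)) ω
    · simp only [if_pos ha, if_pos (ha.mono (m := K - 1 + j) (by omega))]
      exact le_rfl
    · simp [ha]

end Occupation

/-! ### Drift of the truncated delay of an arm -/

section Delays

variable {K : ℕ} {S : Type*}

theorem tremble_apply (η : Set.Ioc (0 : ℝ) 1) (b a : Fin K) : tremble η b a =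
    ENNReal.ofReal ((η : ℝ) / K) + ENNReal.ofReal (1 - η) * if a = b then 1 else 0 := by
  have h1 : (0 : ℝ) ≤ 1 - η := sub_nonneg.2 η.2.2
  have h2 : (0 : ℝ) ≤ (η : ℝ) / K := div_nonneg η.2.1.le (Nat.cast_nonneg K)
  change ENNReal.ofReal ((η : ℝ) / K + (1 - η) * if a = b then 1 else 0) = _
  split_ifs
  · rw [mul_one, mul_one, ENNReal.ofReal_add h2 h1]
  · simp

theorem le_tremble (η : Set.Ioc (0 : ℝ) 1) (b a : Fin K) :
    ENNReal.ofReal ((η : ℝ) / K) ≤ tremble η b a := by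
  rw [tremble_apply]
  exact le_self_add

variable [Fintype S] [DecidableEq S] (η : Set.Ioc (0 : ℝ) 1) (C : ArmsConfig K S)

/-- Sampling `a` resets its delay to `1`; sampling another arm adds at most `1` to the truncated
delay. -/
theorem nextSum_min_delay_add_le (s : DelayState K S) (b a : Fin K) (m : ℕ) :
    nextSum η C s b (fun t => (min (t.d a) m : ℕ)) + tremble η b a * (min (s.d a) m : ℕ) ≤
      1 + (min (s.d a) m : ℕ) := by
  have h1 (c : Fin K) (x : S) : ((min ((s.refresh c x).d a) m : ℕ) : ℝ≥0∞) +
      (if c = a then ((min (s.d a) m : ℕ) : ℝ≥0∞) else 0) ≤ 1 + (min (s.d a) m : ℕ) := by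
    simp only [DelayState.refresh, refresh]
    by_cases hc : c = a
    · simp only [hc, if_true]
      gcongr
      exact_mod_cast min_le_left 1 m
    · simp only [if_neg (Ne.symm hc), if_neg hc, add_zero]
      exact_mod_cast (by omega : min (s.d a + 1) m ≤ 1 + min (s.d a) m)
  calc _ = ∑ c, tremble η b c * ∑ x, row (C.tpm c ^ s.d c) (s.i c) x *
        (((min ((s.refresh c x).d a) m : ℕ) : ℝ≥0∞) +
          (if c = a then ((min (s.d a) m : ℕ) : ℝ≥0∞) else 0)) := by
        simp only [mul_add, Finset.sum_add_distrib]
        congr 1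
        simp only [← Finset.sum_mul, PMF.sum_coe, one_mul]
        simp
    _ ≤ ∑ c, tremble η b c * ∑ x, row (C.tpm c ^ s.d c) (s.i c) x *
        (1 + (min (s.d a) m : ℕ)) := by
        exact Finset.sum_le_sum fun c _ => mul_le_mul_right (Finset.sum_le_sum fun x _ =>
          mul_le_mul_right (h1 c x) _) _
    _ = _ := by simp only [← Finset.sum_mul, PMF.sum_coe, one_mul]

end Delays

/-! ### Tightness of the delays and the information inequality -/

section VisitBounds

variable {K : ℕ} {S : Type*} [Fintype S] [DecidableEq S] [MeasurableSpace S]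
  [DiscreteMeasurableSpace S]
variable (η : Set.Ioc (0 : ℝ) 1) (φ : PMF S) (π : Policy K S) (C : ArmsConfig K S)

/-- A Foster–Lyapunov argument: each visit raises the truncated delay by at most `1` and lowers it
on average by at least `η / K` times its value. Summing over visits telescopes up to the initial
value, at most `K`. -/
theorem mul_tsum_visits_min_delay_le (hT : totalVisits η φ π C ≠ ∞) (a : Fin K) (m : ℕ) :
    ENNReal.ofReal ((η : ℝ) / K) * ∑' s, (∑ b, visits η φ π C s b) * (min (s.d a) m : ℕ) ≤
      K + totalVisits η φ π C := by
  set W := ∑' s, (∑ b, visits η φ π C s b) * ((min (s.d a) m : ℕ) : ℝ≥0∞)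
  -- Truncation at `m` is there to make `W` finite, so that it can be cancelled at the end.
  have hW : W ≠ ∞ := by
    refine ne_top_of_le_ne_top (ENNReal.mul_ne_top hT (ENNReal.natCast_ne_top m)) ?_
    rw [totalVisits, ← ENNReal.tsum_mul_right]
    refine ENNReal.tsum_le_tsum fun s => ?_
    gcongr
    exact min_le_right _ _
  have h1 : W ≤ K + ∑' s, ∑ b, visits η φ π C s b *
      nextSum η C s b (fun t => (min (t.d a) m : ℕ)) :=
    tsum_visits_mul_le η φ π C fun ω => by
      exact_mod_cast (min_le_left _ _).trans (stateAt_zero_delay_le ω a)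
  have h2 : ∑' s, ∑ b, visits η φ π C s b * nextSum η C s b (fun t => (min (t.d a) m : ℕ)) +
      ENNReal.ofReal ((η : ℝ) / K) * W ≤ totalVisits η φ π C + W := by
    rw [← ENNReal.tsum_mul_left, ← ENNReal.tsum_add, totalVisits, ← ENNReal.tsum_add]
    refine ENNReal.tsum_le_tsum fun s => ?_
    rw [← mul_assoc, Finset.mul_sum, Finset.sum_mul, Finset.sum_mul, ← Finset.sum_add_distrib,
      ← Finset.sum_add_distrib]
    refine Finset.sum_le_sum fun b _ => ?_
    calc _ ≤ visits η φ π C s b * (nextSum η C s b (fun t => (min (t.d a) m : ℕ)) +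
          tremble η b a * (min (s.d a) m : ℕ)) := by
          rw [mul_add, mul_comm (ENNReal.ofReal _), mul_assoc]
          gcongr
          exact le_tremble η b a
      _ ≤ visits η φ π C s b * (1 + (min (s.d a) m : ℕ)) := by
          exact mul_le_mul_right (nextSum_min_delay_add_le η C s b a m) _
      _ = _ := by rw [mul_add, mul_one]
  have h3 : ENNReal.ofReal ((η : ℝ) / K) * W + W ≤ K + totalVisits η φ π C + W := by
    calc _ ≤ ENNReal.ofReal ((η : ℝ) / K) * W + (K + ∑' s, ∑ b, visits η φ π C s b *
          nextSum η C s b (fun t => (min (t.d a) m : ℕ))) := by gcongr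
      _ = K + (∑' s, ∑ b, visits η φ π C s b * nextSum η C s b (fun t => (min (t.d a) m : ℕ)) +
          ENNReal.ofReal ((η : ℝ) / K) * W) := by ring
      _ ≤ K + (totalVisits η φ π C + W) := by gcongr
      _ = _ := by ring
  exact (ENNReal.add_le_add_iff_right hW).1 h3

theorem mul_tsum_visits_delay_ge_le (hT : totalVisits η φ π C ≠ ∞) (a : Fin K) (m : ℕ) :
    ENNReal.ofReal ((η : ℝ) / K) * m *
      ∑' s, (if m ≤ s.d a then ∑ b, visits η φ π C s b else 0) ≤ K + totalVisits η φ π C := by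
  refine le_trans ?_ (mul_tsum_visits_min_delay_le η φ π C hT a m)
  rw [mul_assoc, ← ENNReal.tsum_mul_left]
  refine mul_le_mul_right (ENNReal.tsum_le_tsum fun s => ?_) _
  split_ifs with h
  · rw [min_eq_right h, mul_comm]
  · simp

open Classical in
-- The `K - 1` observations of the initial round after time `0` precede the first decision and cost
-- at most `κ` each. All later ones are counted by the visits.
theorem tsum_divergence_le {C' : ArmsConfig K S} {κ : ℝ≥0∞}
    (hκ : ∀ b a, 1 ≤ b.1 a → predictDiv C C' b a ≤ κ) (n : ℕ) :
    ∑ t ∈ Finset.range n, ∫⁻ ω, (if Alive π t ω then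
        ∑ p, armsLaw η π t (obs t ω) p * predictDiv C C' (belief ω t) p.2 else 0)
          ∂law η φ π C ≤
      K * κ + ∑' s, ∑ b, visits η φ π C s b * ∑ a, tremble η b a * armDivergence C C' s a := by
  set D : ℕ → ℝ≥0∞ := fun t => ∫⁻ ω, (if Alive π t ω then
        ∑ p, armsLaw η π t (obs t ω) p * predictDiv C C' (belief ω t) p.2 else 0) ∂law η φ π C
  have h1 (t : ℕ) : D t ≤ κ := by
    calc D t ≤ ∫⁻ ω, κ ∂law η φ π C := by
          refine lintegral_mono fun ω => ?_
          split_ifs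
          · calc _ ≤ ∑ p, armsLaw η π t (obs t ω) p * κ := by
                  gcongr with p _
                  exact hκ _ _ (one_le_belief ω t p.2)
              _ = κ := by rw [← Finset.sum_mul, PMF.sum_coe, one_mul]
          · exact zero_le
      _ = κ := by simp
  have h2 : ∑' s, ∑ b, visits η φ π C s b * ∑ a, tremble η b a * armDivergence C C' s a =
      ∑' j, D (K - 1 + j) := by
    rw [tsum_visits_mul η φ π C fun s b => ∑ a, tremble η b a * armDivergence C C' s a]
    refine tsum_congr fun j => lintegral_congr fun ω => ?_
    rw [sum_armsLaw_mul η π (by omega) ω fun a => predictDiv C C' (belief ω (K - 1 + j)) a]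
    simp only [← stateAt_spec]
    rfl
  rw [h2]
  calc ∑ t ∈ Finset.range n, D t ≤ ∑ t ∈ Finset.range (K - 1 + n), D t :=
        Finset.sum_le_sum_of_subset (Finset.range_subset_range.2 (by omega))
    _ = ∑ t ∈ Finset.range (K - 1), D t + ∑ j ∈ Finset.range n, D (K - 1 + j) :=
        Finset.sum_range_add _ _ _
    _ ≤ ∑ t ∈ Finset.range (K - 1), κ + ∑' j, D (K - 1 + j) :=
        add_le_add (Finset.sum_le_sum fun t _ => h1 t) (ENNReal.sum_le_tsum _)
    _ ≤ _ := by
        rw [Finset.sum_const, Finset.card_range, nsmul_eq_mul]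
        gcongr
        exact Nat.sub_le _ _

theorem one_sub_le_measure_declares {ε : ℝ} (hε : 0 ≤ ε) (hπ : π ∈ admissible η φ ε)
    (hT : totalVisits η φ π C ≠ ∞) :
    1 - ε ≤ (law η φ π C).real {ω | ∃ n, DeclaresBy π C.h n ω} := by
  classical
  set P := law η φ π C
  have hA (n : ℕ) : MeasurableSet {ω : ℕ → Step K S | Alive π n ω} :=
    measurableSet_setOfPred.2 (measurable_of_dependsOn (observedBy_alive π n).dependsOn)
  -- Finitely many expected decisions imply stoppage almost surely, so the only alternative to the
  -- correct declaration is an error.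
  have h0 : P (⋂ j, {ω | Alive π (K - 1 + j) ω}) = 0 := by
    rw [totalVisits_eq] at hT
    have hlim := ENNReal.tendsto_atTop_zero_of_tsum_ne_top hT
    refine le_antisymm (ge_of_tendsto' hlim fun j => ?_) zero_le
    have : ∫⁻ ω, (if Alive π (K - 1 + j) ω then 1 else 0) ∂P = P {ω | Alive π (K - 1 + j) ω} := by
      rw [← lintegral_indicator_one (hA _)]
      rfl
    rw [this]
    exact measure_mono (Set.iInter_subset _ j)
  have hcov : (Set.univ : Set (ℕ → Step K S)) ⊆ ((⋂ j, {ω | Alive π (K - 1 + j) ω}) ∪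
      wrongDecision π C.h) ∪ {ω | ∃ n, DeclaresBy π C.h n ω} := by
    intro ω _
    by_cases h : ∃ j, ¬Alive π (K - 1 + j) ω
    · obtain ⟨j, hj⟩ := h
      obtain ⟨m, -, hm⟩ := exists_stopsAt_of_not_alive hj
      obtain ⟨θ, hθ⟩ := Sum.isRight_iff.1 hm.2.2
      by_cases hh : θ = C.h
      · exact Or.inr ⟨m, m, le_rfl, hm, hh ▸ hθ⟩
      · exact Or.inl (Or.inr ⟨m, hm.stopTime_eq, θ, hθ, hh⟩)
    · push Not at h
      exact Or.inl (Or.inl (Set.mem_iInter.2 h))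
  have h1 : 1 ≤ ENNReal.ofReal ε + P {ω | ∃ n, DeclaresBy π C.h n ω} := by
    calc (1 : ℝ≥0∞) = P Set.univ := measure_univ.symm
      _ ≤ _ := measure_mono hcov
      _ ≤ (P (⋂ j, {ω | Alive π (K - 1 + j) ω}) + P (wrongDecision π C.h)) +
          P {ω | ∃ n, DeclaresBy π C.h n ω} :=
        (measure_union_le _ _).trans (by gcongr; exact measure_union_le _ _)
      _ ≤ _ := by
        rw [h0, zero_add]
        gcongr
        exact hπ C
  have h2 := ENNReal.toReal_mono (by finiteness) h1
  rw [ENNReal.toReal_add (by finiteness) (by finiteness), ENNReal.toReal_ofReal hε,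
    ENNReal.toReal_one] at h2
  change 1 - ε ≤ (P _).toReal
  linarith

/-- The information that a policy must gather before stopping in order to be admissible. -/
theorem ofReal_log_le_divergence {C' : ArmsConfig K S} (hac : Dominated C C')
    (hh : C.h ≠ C'.h) {κ : ℝ≥0∞} (hκ : ∀ b a, 1 ≤ b.1 a → predictDiv C C' b a ≤ κ)
    {ε : ℝ} (hε : 0 < ε) (hε1 : ε ≤ 1) (hπ : π ∈ admissible η φ ε)
    (hT : totalVisits η φ π C ≠ ∞) :
    ENNReal.ofReal (Real.log (1 / ε) * (1 - ε) - Real.log 2) ≤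
      K * κ + ∑' s, ∑ b, visits η φ π C s b * ∑ a, tremble η b a * armDivergence C C' s a := by
  have hlim : Tendsto (fun n => (law η φ π C).real {ω | DeclaresBy π C.h n ω}) atTop
      (𝓝 ((law η φ π C).real {ω | ∃ n, DeclaresBy π C.h n ω})) := by
    have hmono : Monotone fun n => {ω : ℕ → Step K S | DeclaresBy π C.h n ω} :=
      fun m n hmn ω ⟨k, hk, h⟩ => ⟨k, hk.trans hmn, h⟩
    have := tendsto_measure_iUnion_atTop (μ := law η φ π C) hmono
    have h2 := (ENNReal.tendsto_toReal (measure_ne_top _ _)).comp this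
    have e : {ω : ℕ → Step K S | ∃ n, DeclaresBy π C.h n ω} = ⋃ n, {ω | DeclaresBy π C.h n ω} := by
      ext ω
      simp
    rw [e]
    exact h2
  have hle : ENNReal.ofReal (Real.log (1 / ε) *
      (law η φ π C).real {ω | ∃ n, DeclaresBy π C.h n ω} - Real.log 2) ≤
      K * κ + ∑' s, ∑ b, visits η φ π C s b * ∑ a, tremble η b a * armDivergence C C' s a :=
    le_of_tendsto' (ENNReal.tendsto_ofReal ((hlim.const_mul _).sub_const _)) fun n =>
      (ofReal_log_mul_measure_declaresBy_le η φ π hac hh hε hπ n).trans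
        (tsum_divergence_le η φ π C hκ n)
  refine le_trans (ENNReal.ofReal_le_ofReal ?_) hle
  have hlog : 0 ≤ Real.log (1 / ε) := Real.log_nonneg ((one_le_div hε).2 hε1)
  have := mul_le_mul_of_nonneg_left (one_sub_le_measure_declares η φ π C hε.le hπ hT) hlog
  linarith

end VisitBounds

/-! ### Uniform bounds from ergodicity -/

section Ergodic

variable {S : Type*} [Fintype S] [DecidableEq S]

theorem exists_row_ne_zero (P : Matrix.rowStochastic ℝ S) (i : S) : ∃ x, row P i x ≠ 0 := by
  obtain ⟨x, hx⟩ := (row P i).support_nonempty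
  exact ⟨x, hx⟩

/-- A lower bound for the entries of a matrix is inherited by its products on the left with
stochastic matrices. -/
theorem le_row_pow_of_le {P : Matrix.rowStochastic ℝ S} {M : ℕ} {δ : ℝ≥0∞}
    (h : ∀ i j, δ ≤ row (P ^ M) i j) {d : ℕ} (hd : M ≤ d) (i j : S) : δ ≤ row (P ^ d) i j := by
  obtain ⟨e, rfl⟩ := Nat.exists_eq_add_of_le hd
  calc δ = ∑ z, row (P ^ e) i z * δ := by rw [← Finset.sum_mul, PMF.sum_coe, one_mul]
    _ ≤ _ := by
      rw [add_comm, pow_add, row_mul]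
      exact Finset.sum_le_sum fun z _ => mul_le_mul_right (h z j) _

theorem exists_le_row_pow {P : Matrix.rowStochastic ℝ S} (hP : (P : Matrix S S ℝ).IsPrimitive) :
    ∃ (M : ℕ) (δ : ℝ), 0 < δ ∧ ∀ d, M ≤ d → ∀ i j, ENNReal.ofReal δ ≤ row (P ^ d) i j := by
  obtain ⟨M, -, hM⟩ := hP.2
  have h1 (i j : S) : 0 < ((P ^ M : Matrix.rowStochastic ℝ S) : Matrix S S ℝ) i j := by
    rw [SubmonoidClass.coe_pow]
    exact hM i j
  obtain ⟨δ, hδ, hδ'⟩ : ∃ δ : ℝ, 0 < δ ∧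
      ∀ p : S × S, δ ≤ ((P ^ M : Matrix.rowStochastic ℝ S) : Matrix S S ℝ) p.1 p.2 := by
    rcases isEmpty_or_nonempty (S × S) with he | he
    · exact ⟨1, one_pos, fun p => he.elim p⟩
    · obtain ⟨p, hp⟩ := Finite.exists_min fun p : S × S =>
        ((P ^ M : Matrix.rowStochastic ℝ S) : Matrix S S ℝ) p.1 p.2
      exact ⟨_, h1 p.1 p.2, hp⟩
  refine ⟨M, δ, hδ, fun d hd => le_row_pow_of_le (fun i j => ?_) hd⟩
  rw [row_apply]
  exact ENNReal.ofReal_le_ofReal (hδ' (i, j))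

variable {K : ℕ}

theorem ArmsConfig.tpm_isPrimitive (C : ArmsConfig K S) (a : Fin K) :
    (C.tpm a : Matrix S S ℝ).IsPrimitive := by
  unfold ArmsConfig.tpm
  split_ifs
  · exact C.ergodic₁
  · exact C.ergodic₂

/-- For large delays the entries under `C'` are bounded below, which bounds the divergence. The
finitely many small delays give finite values by domination. -/
theorem exists_predictDiv_le [MeasurableSpace S] [DiscreteMeasurableSpace S]
    {C C' : ArmsConfig K S} (hac : Dominated C C') :
    ∃ κ : ℝ≥0∞, κ ≠ ∞ ∧ ∀ b a, 1 ≤ b.1 a → predictDiv C C' b a ≤ κ := by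
  choose M δ hδ hM using fun a => exists_le_row_pow (C'.tpm_isPrimitive a)
  let D (a : Fin K) (d : ℕ) (i : S) : ℝ≥0∞ := InformationTheory.klDiv
    (row (C.tpm a ^ d) i).toMeasure (row (C'.tpm a ^ d) i).toMeasure
  have hD (a : Fin K) (d : ℕ) (i : S) (hd : 1 ≤ d) : D a d i ≠ ∞ := by
    simp only [D]
    rw [ne_eq, klDiv_toMeasure_eq_top_iff]
    rintro ⟨x, hx, hx'⟩
    exact hx' (hac a d i x hd hx)
  refine ⟨∑ a, (ENNReal.ofReal (-Real.log (δ a)) +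
    ∑ d ∈ Finset.Icc 1 (M a), ∑ i, D a d i), ?_, fun b a hb => ?_⟩
  · refine ENNReal.sum_ne_top.2 fun a _ => ENNReal.add_ne_top.2 ⟨ENNReal.ofReal_ne_top,
      ENNReal.sum_ne_top.2 fun d hd => ENNReal.sum_ne_top.2 fun i _ =>
        hD a d i (Finset.mem_Icc.1 hd).1⟩
  · refine le_trans ?_ (Finset.single_le_sum_of_canonicallyOrdered (Finset.mem_univ a))
    change D a (b.1 a) (b.2 a) ≤ _
    rcases le_total (M a) (b.1 a) with h | h
    · refine le_trans ?_ le_self_add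
      refine klDiv_toMeasure_le_log _ _ (hδ a) fun x => ?_
      exact (ENNReal.ofReal_le_iff_le_toReal (PMF.apply_ne_top _ _)).1 (hM a _ h _ x)
    · refine le_trans ?_ le_add_self
      refine le_trans ?_ (Finset.single_le_sum_of_canonicallyOrdered (Finset.mem_Icc.2 ⟨hb, h⟩))
      exact Finset.single_le_sum_of_canonicallyOrdered (f := fun i => D a (b.1 a) i)
        (Finset.mem_univ (b.2 a))

end Ergodic

/-! ### The support of a stationary distribution -/

section Stationary

variable {K : ℕ} {S : Type*} [Fintype S] [DecidableEq S]
variable {η : Set.Ioc (0 : ℝ) 1} {C : ArmsConfig K S} {lam : DelayState K S → PMF (Fin K)}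
  {μ : PMF (DelayState K S)}

theorem ofReal_div_ne_zero (η : Set.Ioc (0 : ℝ) 1) (a : Fin K) :
    ENNReal.ofReal ((η : ℝ) / K) ≠ 0 := by
  have h1 := η.2.1
  have h2 : (0 : ℝ) < K := by exact_mod_cast Fin.pos a
  simpa using div_pos h1 h2

/-- The trembling hand samples every arm with positive probability whatever the strategy intends, so
the support is closed under every possible refresh. -/
theorem IsStationary.refresh_ne_zero (h : IsStationary η C lam μ) {s : DelayState K S}
    (hs : μ s ≠ 0) (a : Fin K) {x : S} (hx : row (C.tpm a ^ s.d a) (s.i a) x ≠ 0) :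
    μ (s.refresh a x) ≠ 0 := by
  classical
  intro h0
  have h1 := h (s.refresh a x)
  rw [h0, ENNReal.tsum_eq_zero] at h1
  obtain ⟨b, hb⟩ := (lam s).support_nonempty
  have h2 := (mul_eq_zero.1 (h1 s)).resolve_left hs
  have h3 := (mul_eq_zero.1 (Finset.sum_eq_zero_iff.1 h2 b (Finset.mem_univ b))).resolve_left hb
  rw [← nextSum_single, nextSum] at h3
  have h4 := (mul_eq_zero.1 (Finset.sum_eq_zero_iff.1 h3 a (Finset.mem_univ a))).resolve_left
    fun h => ofReal_div_ne_zero η a (le_antisymm ((le_tremble η b a).trans h.le) zero_le)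
  have h5 := Finset.sum_eq_zero_iff.1 h4 x (Finset.mem_univ x)
  simp [hx] at h5

/-- A stationary distribution charges every delay and every last observed state of each arm. -/
theorem IsStationary.exists_delay_eq (hK : 2 ≤ K) (h : IsStationary η C lam μ) (a : Fin K)
    {d : ℕ} (hd : 1 ≤ d) (i : S) : ∃ s, μ s ≠ 0 ∧ s.d a = d ∧ s.i a = i := by
  have : Nontrivial (Fin K) := Fin.nontrivial_iff_two_le.2 hK
  obtain ⟨c, hc⟩ := exists_ne a
  -- Sampling the other arm `c` repeatedly ages `a` without changing its last observed state.
  have hwait (s : DelayState K S) (hs : μ s ≠ 0) (e : ℕ) :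
      ∃ t, μ t ≠ 0 ∧ t.d a = s.d a + e ∧ t.i a = s.i a := by
    induction e with
    | zero => exact ⟨s, hs, rfl, rfl⟩
    | succ e ih =>
      obtain ⟨t, ht, h1, h2⟩ := ih
      obtain ⟨x, hx⟩ := exists_row_ne_zero (C.tpm c ^ t.d c) (t.i c)
      refine ⟨t.refresh c x, h.refresh_ne_zero ht c hx, ?_, ?_⟩
      · simp [DelayState.refresh, refresh, hc.symm, h1, add_assoc]
      · simp [DelayState.refresh, refresh, hc.symm, h2]
  obtain ⟨s₀, hs₀⟩ := μ.support_nonempty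
  obtain ⟨M, δ, hδ, hM⟩ := exists_le_row_pow (C.tpm_isPrimitive a)
  obtain ⟨s, hs, h1, -⟩ := hwait s₀ hs₀ M
  have hi : row (C.tpm a ^ s.d a) (s.i a) i ≠ 0 := fun h0 => by
    have := hM (s.d a) (by omega) (s.i a) i
    rw [h0, nonpos_iff_eq_zero, ENNReal.ofReal_eq_zero] at this
    linarith
  obtain ⟨t, ht, h2, h3⟩ := hwait _ (h.refresh_ne_zero hs a hi) (d - 1)
  refine ⟨t, ht, ?_, ?_⟩
  · rw [h2]
    simp only [DelayState.refresh, refresh, if_true]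
    omega
  · rw [h3]
    simp [DelayState.refresh, refresh]

/-- Some transition possible under `C` is impossible under `C'`; its delay and starting state are
charged by `μ`, and the arm is sampled there with positive probability. -/
theorem IsStationary.tsum_occupancy_mul_eq_top [MeasurableSpace S] [DiscreteMeasurableSpace S]
    (hK : 2 ≤ K) (h : IsStationary η C lam μ) {C' : ArmsConfig K S} (hac : ¬Dominated C C') :
    ∑' s, ∑ a, occupancy η lam μ s a * armDivergence C C' s a = ∞ := by
  unfold Dominated at hac
  push Not at hac
  obtain ⟨a, d, i, x, hd, h0, h1⟩ := hac
  obtain ⟨s, hs, rfl, rfl⟩ := h.exists_delay_eq hK a hd i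
  have hD : armDivergence C C' s a = ∞ := (klDiv_toMeasure_eq_top_iff _ _).2 ⟨x, h0, h1⟩
  refine top_unique (le_trans ?_ (ENNReal.le_tsum s))
  refine le_trans ?_ (Finset.single_le_sum_of_canonicallyOrdered (Finset.mem_univ a))
  rw [hD, ENNReal.mul_top]
  exact mul_ne_zero hs fun h' => ofReal_div_ne_zero η a (add_eq_zero.1 h').1

end Stationary

/-! ### An alternative that is never excluded by a single observation -/

section Alternative

variable {K : ℕ} {S : Type*} [Fintype S] [DecidableEq S]

theorem row_pow_ne_zero {P : Matrix.rowStochastic ℝ S} (hP : ∀ i j, row P i j ≠ 0) {d : ℕ}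
    (hd : 1 ≤ d) (i j : S) : row (P ^ d) i j ≠ 0 := by
  obtain ⟨e, rfl⟩ := Nat.exists_eq_add_of_le' hd
  rw [row_pow_succ]
  obtain ⟨z, hz⟩ := exists_row_ne_zero (P ^ e) i
  exact fun h => mul_ne_zero hz (hP z j) (Finset.sum_eq_zero_iff.1 h z (Finset.mem_univ z))

/-- The average of a stochastic matrix and the uniform one. -/
noncomputable def smoothed [Nonempty S] (P : Matrix.rowStochastic ℝ S) :
    Matrix.rowStochastic ℝ S :=
  ⟨Matrix.of fun i j => ((P : Matrix S S ℝ) i j + (Fintype.card S : ℝ)⁻¹) / 2, by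
    rw [Matrix.mem_rowStochastic_iff_sum]
    refine ⟨fun i j => ?_, fun i => ?_⟩
    · have := Matrix.nonneg_of_mem_rowStochastic P.2 (i := i) (j := j)
      simp only [Matrix.of_apply]
      positivity
    · simp only [Matrix.of_apply]
      rw [← Finset.sum_div, Finset.sum_add_distrib, Matrix.sum_row_of_mem_rowStochastic P.2]
      simp⟩

theorem smoothed_pos [Nonempty S] (P : Matrix.rowStochastic ℝ S) (i j : S) :
    0 < (smoothed P : Matrix S S ℝ) i j := by
  have := Matrix.nonneg_of_mem_rowStochastic P.2 (i := i) (j := j)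
  change 0 < ((P : Matrix S S ℝ) i j + (Fintype.card S : ℝ)⁻¹) / 2
  positivity

theorem smoothed_isPrimitive [Nonempty S] (P : Matrix.rowStochastic ℝ S) :
    (smoothed P : Matrix S S ℝ).IsPrimitive :=
  ⟨fun i j => (smoothed_pos P i j).le, 1, one_pos, fun i j => by
    rw [pow_one]; exact smoothed_pos P i j⟩

theorem smoothed_injective [Nonempty S] :
    Function.Injective (smoothed : Matrix.rowStochastic ℝ S → Matrix.rowStochastic ℝ S) := by
  intro P Q h
  refine Subtype.ext (Matrix.ext fun i j => ?_)
  have h1 := congrArg (fun A : Matrix.rowStochastic ℝ S => (A : Matrix S S ℝ) i j) h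
  simp only [smoothed, Matrix.of_apply] at h1
  linarith

/-- Matrices with positive entries dominate everything. Such an alternative is what forces the
number of decisions to infinity; `smoothed` is injective, so its two matrices stay distinct. -/
theorem exists_dominated (hK : 2 ≤ K) (C : ArmsConfig K S) :
    ∃ C' : ArmsConfig K S, C'.h ≠ C.h ∧ Dominated C C' := by
  have : Nontrivial (Fin K) := Fin.nontrivial_iff_two_le.2 hK
  obtain ⟨h', hh'⟩ := exists_ne C.h
  have : Nonempty S := by
    by_contra hS
    rw [not_nonempty_iff] at hS
    exact C.ne (Subtype.ext (Matrix.ext fun i => hS.elim i))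
  refine ⟨⟨h', smoothed C.P₁, smoothed C.P₂, smoothed_isPrimitive _, smoothed_isPrimitive _,
    smoothed_injective.ne C.ne⟩, hh', fun a d i x hd h0 => absurd h0 ?_⟩
  refine row_pow_ne_zero (fun i j => ?_) hd i x
  rw [row_apply, ne_eq, ENNReal.ofReal_eq_zero, not_le]
  unfold ArmsConfig.tpm
  split_ifs
  all_goals exact smoothed_pos _ i j

end Alternative

/-! ### Limits of normalised visits along an ultrafilter -/

section Limit

variable {K : ℕ} {S : Type*} {ι : Type*} (U : Ultrafilter ι)
  (V : ι → DelayState K S → Fin K → ℝ≥0∞)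

/-- The pointwise limit of a family along an ultrafilter. -/
noncomputable def ultralimit (s : DelayState K S) (b : Fin K) : ℝ≥0∞ :=
  (U.map fun i => V i s b).lim

/-- `ℝ≥0∞` is compact, so no subsequence has to be extracted. -/
theorem tendsto_ultralimit (s : DelayState K S) (b : Fin K) :
    Tendsto (fun i => V i s b) U (𝓝 (ultralimit U V s b)) :=
  (U.map fun i => V i s b).le_nhds_lim

theorem finite_delay_lt [Finite S] (m : ℕ) : {s : DelayState K S | ∀ a, s.d a < m}.Finite := by
  have h : ((Set.univ.pi fun _ : Fin K => Set.Iio m) ×ˢ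
      (Set.univ : Set (Fin K → S))).Finite :=
    (Set.Finite.pi' fun _ => Set.finite_Iio m).subset (by intro x hx a; exact hx a trivial)
      |>.prod Set.finite_univ
  refine (h.preimage (f := fun s : DelayState K S => (s.d, s.i))
    fun s _ t _ hst => ?_).subset fun s hs => ⟨fun a _ => hs a, trivial⟩
  exact DelayState.ext (congrArg Prod.fst hst) (congrArg Prod.snd hst)

/-- Outside the finite set of states with all delays below `m`, some arm has delay at least `m`. A
union bound over the arms controls the remaining mass. -/
theorem tsum_mul_le_sum_add [Finite S] {V : DelayState K S → Fin K → ℝ≥0∞} {c : ℝ≥0∞}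
    (hc : ∀ (a : Fin K) (m : ℕ), m * ∑' s, (if m ≤ s.d a then ∑ b, V s b else 0) ≤ c)
    {k : DelayState K S → Fin K → ℝ≥0∞} {κ : ℝ≥0∞} (hk : ∀ s b, k s b ≤ κ) {m : ℕ}
    (hm : m ≠ 0) : ∑' s, ∑ b, V s b * k s b ≤
      ∑ s ∈ (finite_delay_lt (K := K) (S := S) m).toFinset, ∑ b, V s b * k s b +
        κ * (K * (c * (m : ℝ≥0∞)⁻¹)) := by
  classical
  have h1 (s : DelayState K S) : ∑ b, V s b * k s b ≤
      (if s ∈ (finite_delay_lt (K := K) (S := S) m).toFinset then ∑ b, V s b * k s b else 0) +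
        κ * ∑ a, (if m ≤ s.d a then ∑ b, V s b else 0) := by
    by_cases hs : ∀ a, s.d a < m
    · rw [if_pos (by simpa using hs)]
      exact le_self_add
    · push Not at hs
      obtain ⟨a, ha⟩ := hs
      refine le_trans ?_ le_add_self
      calc ∑ b, V s b * k s b ≤ ∑ b, V s b * κ := by
            gcongr with b _
            exact hk s b
        _ = κ * (if m ≤ s.d a then ∑ b, V s b else 0) := by
            rw [if_pos ha, ← Finset.sum_mul, mul_comm]
        _ ≤ _ := by
            gcongr
            exact Finset.single_le_sum_of_canonicallyOrdered
              (f := fun a => if m ≤ s.d a then ∑ b, V s b else 0) (Finset.mem_univ a)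
  have hm0 : (m : ℝ≥0∞) ≠ 0 := by exact_mod_cast hm
  calc _ ≤ ∑' s, ((if s ∈ (finite_delay_lt (K := K) (S := S) m).toFinset then
          ∑ b, V s b * k s b else 0) + κ * ∑ a, (if m ≤ s.d a then ∑ b, V s b else 0)) :=
        ENNReal.tsum_le_tsum h1
    _ = ∑ s ∈ (finite_delay_lt (K := K) (S := S) m).toFinset, ∑ b, V s b * k s b +
          κ * ∑ a, ∑' s, (if m ≤ s.d a then ∑ b, V s b else 0) := by
        rw [ENNReal.tsum_add, ENNReal.tsum_mul_left,
          Summable.tsum_finsetSum fun _ _ => ENNReal.summable,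
          tsum_eq_sum (s := (finite_delay_lt (K := K) (S := S) m).toFinset)
            fun s hs => if_neg hs]
        congr 1
        exact Finset.sum_congr rfl fun s hs => if_pos hs
    _ ≤ ∑ s ∈ (finite_delay_lt (K := K) (S := S) m).toFinset, ∑ b, V s b * k s b +
          κ * ∑ a : Fin K, c * (m : ℝ≥0∞)⁻¹ := by
        gcongr with a _
        rw [← div_eq_mul_inv, ENNReal.le_div_iff_mul_le (Or.inl hm0)
          (Or.inl (ENNReal.natCast_ne_top m)), mul_comm]
        exact hc a m
    _ = _ := by simp

/-- Bounded functions can be integrated in the limit, because the delays are tight. -/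
theorem le_tsum_ultralimit_mul [Finite S] {c : ℝ≥0∞} (hc' : c ≠ ∞)
    (hc : ∀ᶠ i in U, ∀ (a : Fin K) (m : ℕ),
      m * ∑' s, (if m ≤ s.d a then ∑ b, V i s b else 0) ≤ c)
    {k : DelayState K S → Fin K → ℝ≥0∞} {κ : ℝ≥0∞} (hκ : κ ≠ ∞) (hk : ∀ s b, k s b ≤ κ)
    {r : ℝ≥0∞} {θ : ι → ℝ≥0∞} (hθ : Tendsto θ U (𝓝 0))
    (hr : ∀ᶠ i in U, r ≤ θ i + ∑' s, ∑ b, V i s b * k s b) :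
    r ≤ ∑' s, ∑ b, ultralimit U V s b * k s b := by
  -- For fixed `m` only a finite sum has to pass to the limit; the tail error then vanishes as `m →
  -- ∞`.
  have h1 (m : ℕ) (hm : m ≠ 0) : r ≤ ∑' s, ∑ b, ultralimit U V s b * k s b +
      κ * (K * (c * (m : ℝ≥0∞)⁻¹)) := by
    set F := (finite_delay_lt (K := K) (S := S) m).toFinset
    have hlim : Tendsto (fun i => θ i + (∑ s ∈ F, ∑ b, V i s b * k s b +
        κ * (K * (c * (m : ℝ≥0∞)⁻¹)))) U (𝓝 (0 + (∑ s ∈ F, ∑ b, ultralimit U V s b * k s b +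
        κ * (K * (c * (m : ℝ≥0∞)⁻¹))))) := by
      refine hθ.add (Tendsto.add_const _ (tendsto_finsetSum _ fun s _ =>
        tendsto_finsetSum _ fun b _ => ?_))
      exact ENNReal.Tendsto.mul_const (tendsto_ultralimit U V s b)
        (Or.inr (ne_top_of_le_ne_top hκ (hk s b)))
    have h2 := ge_of_tendsto hlim (b := r) (by
      filter_upwards [hc, hr] with i hci hri
      refine hri.trans ?_
      gcongr
      exact tsum_mul_le_sum_add hci hk hm)
    rw [zero_add] at h2
    refine h2.trans ?_
    gcongr
    exact ENNReal.sum_le_tsum _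
  have hlim : Tendsto (fun m : ℕ => ∑' s, ∑ b, ultralimit U V s b * k s b +
      κ * (K * (c * (m : ℝ≥0∞)⁻¹))) atTop (𝓝 (∑' s, ∑ b, ultralimit U V s b * k s b +
      κ * (K * (c * 0)))) := by
    refine Tendsto.const_add _ (ENNReal.Tendsto.const_mul (ENNReal.Tendsto.const_mul
      (ENNReal.Tendsto.const_mul ENNReal.tendsto_inv_nat_nhds_zero (Or.inr hc')) (Or.inr ?_))
      (Or.inr hκ))
    exact ENNReal.natCast_ne_top K
  have h3 := ge_of_tendsto hlim (b := r) (by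
    filter_upwards [eventually_ne_atTop 0] with m hm using h1 m hm)
  simpa using h3

variable [Fintype S] [DecidableEq S]

theorem transProb_ne_top (η : Set.Ioc (0 : ℝ) 1) (C : ArmsConfig K S) (s : DelayState K S)
    (b : Fin K) (s' : DelayState K S) : transProb η C s b s' ≠ ∞ := by
  classical
  refine ne_top_of_le_ne_top ENNReal.one_ne_top ?_
  have h := tsum_transProb_mul η C s b fun _ => 1
  rw [nextSum_one] at h
  simp only [mul_one] at h
  rw [← h]
  exact ENNReal.le_tsum s'

/-- A probability measure on states and intended arms that satisfies the balance inequalities is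
the stationary one of a stationary randomised strategy. -/
theorem exists_isStationary (hK : 0 < K) (η : Set.Ioc (0 : ℝ) 1) (C : ArmsConfig K S)
    {v : DelayState K S → Fin K → ℝ≥0∞} (h1 : ∑' s, ∑ b, v s b = 1)
    (h2 : ∀ s', ∑' s, ∑ b, v s b * transProb η C s b s' ≤ ∑ b, v s' b) :
    ∃ (lam : DelayState K S → PMF (Fin K)) (μ : PMF (DelayState K S)), IsStationary η C lam μ ∧
      ∀ D : DelayState K S → Fin K → ℝ≥0∞, ∑' s, ∑ a, occupancy η lam μ s a * D s a =
        ∑' s, ∑ b, v s b * ∑ a, tremble η b a * D s a := by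
  classical
  let μ : PMF (DelayState K S) := ⟨fun s => ∑ b, v s b, h1 ▸ ENNReal.summable.hasSum⟩
  have hμ (s : DelayState K S) : μ s = ∑ b, v s b := rfl
  -- The conditional law of the arm given the state; its value at null states is arbitrary.
  let lam (s : DelayState K S) : PMF (Fin K) :=
    if h : ∑' b, v s b ≠ 0 then PMF.normalize (v s) h (by
      rw [tsum_fintype]; exact PMF.apply_ne_top μ s) else PMF.pure ⟨0, hK⟩
  have hlam (s : DelayState K S) (b : Fin K) : μ s * lam s b = v s b := by
    by_cases h : ∑' b, v s b ≠ 0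
    · simp only [lam, dif_pos h, PMF.normalize_apply]
      rw [tsum_fintype] at h ⊢
      rw [hμ, mul_left_comm, ENNReal.mul_inv_cancel h (PMF.apply_ne_top μ s), mul_one]
    · push Not at h
      rw [tsum_fintype] at h
      rw [hμ, h, zero_mul, Finset.sum_eq_zero_iff.1 h b (Finset.mem_univ b)]
  refine ⟨lam, μ, fun s' => ?_, fun D => ?_⟩
  · let g (s' : DelayState K S) : ℝ≥0∞ := ∑' s, ∑ b, v s b * transProb η C s b s'
    have hg : ∑' s', g s' = 1 := by
      simp only [g]
      rw [ENNReal.tsum_comm, ← h1]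
      refine tsum_congr fun s => ?_
      rw [Summable.tsum_finsetSum fun _ _ => ENNReal.summable]
      refine Finset.sum_congr rfl fun b _ => ?_
      rw [ENNReal.tsum_mul_left]
      have h := tsum_transProb_mul η C s b fun _ => 1
      rw [nextSum_one] at h
      simp only [mul_one] at h
      rw [h, mul_one]
    -- Both sides have total mass `1`, so a strict inequality at one state would contradict the
    -- balance inequalities at all the others.
    have hgμ : g s' = μ s' := by
      refine le_antisymm (h2 s') (not_lt.1 fun hlt => ?_)
      have := ENNReal.tsum_lt_tsum (by rw [hg]; exact ENNReal.one_ne_top) h2 hlt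
      rw [hg, h1] at this
      exact lt_irrefl _ this
    rw [← hgμ]
    refine tsum_congr fun s => ?_
    simp only [Finset.mul_sum, ← mul_assoc, hlam]
  · refine tsum_congr fun s => ?_
    simp only [Finset.mul_sum]
    rw [Finset.sum_comm]
    refine Finset.sum_congr rfl fun a _ => ?_
    simp only [← mul_assoc, ← Finset.sum_mul]
    congr 1
    simp only [occupancy, tremble_apply, mul_add, Finset.sum_add_distrib, ← Finset.sum_mul, hμ]
    congr 1
    rw [← hμ, mul_left_comm, hlam]
    simp [mul_comm]

/-- A Fatou argument: finite partial sums pass to the limit, and the right side is a finite sum.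
Equality is recovered later by comparing masses. -/
theorem tsum_ultralimit_mul_transProb_le (η : Set.Ioc (0 : ℝ) 1) (C : ArmsConfig K S)
    {θ : ι → ℝ≥0∞} (hθ : Tendsto θ U (𝓝 0)) (s' : DelayState K S)
    (h : ∀ᶠ i in U, ∑' s, ∑ b, V i s b * transProb η C s b s' ≤ ∑ b, V i s' b + θ i) :
    ∑' s, ∑ b, ultralimit U V s b * transProb η C s b s' ≤ ∑ b, ultralimit U V s' b := by
  refine ENNReal.summable.tsum_le_of_sum_le fun F => ?_
  have h1 : Tendsto (fun i => ∑ s ∈ F, ∑ b, V i s b * transProb η C s b s') U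
      (𝓝 (∑ s ∈ F, ∑ b, ultralimit U V s b * transProb η C s b s')) :=
    tendsto_finsetSum _ fun s _ => tendsto_finsetSum _ fun b _ =>
      ENNReal.Tendsto.mul_const (tendsto_ultralimit U V s b) (Or.inr (transProb_ne_top η C s b s'))
  have h2 : Tendsto (fun i => ∑ b, V i s' b + θ i) U (𝓝 (∑ b, ultralimit U V s' b + 0)) :=
    (tendsto_finsetSum _ fun b _ => tendsto_ultralimit U V s' b).add hθ
  rw [add_zero] at h2
  refine le_of_tendsto_of_tendsto h1 h2 ?_
  filter_upwards [h] with i hi using (ENNReal.sum_le_tsum F).trans hi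

end Limit

/-! ### From fast policies to a stationary strategy -/

section LowerBound

variable {K : ℕ} {S : Type*} [Fintype S] [DecidableEq S] [MeasurableSpace S]
  [DiscreteMeasurableSpace S]
variable (η : Set.Ioc (0 : ℝ) 1) (φ : PMF S) (C : ArmsConfig K S)

theorem ofReal_log_le_add_divergence (π : Policy K S) {C' : ArmsConfig K S}
    (hac : Dominated C C') (hh : C.h ≠ C'.h) {κ : ℝ≥0∞}
    (hκ : ∀ b a, 1 ≤ b.1 a → predictDiv C C' b a ≤ κ)
    {ε : ℝ} (hε : 0 < ε) (hε1 : ε ≤ 1) (hπ : π ∈ admissible η φ ε)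
    (hT : totalVisits η φ π C ≠ ∞) :
    ENNReal.ofReal (Real.log (1 / ε)) ≤ (ENNReal.ofReal (1 + Real.log 2) + K * κ) +
      ∑' s, ∑ b, visits η φ π C s b * ∑ a, tremble η b a * armDivergence C C' s a := by
  -- This absorbs the factor `1 - ε` into the additive constant.
  have h1 : ε * Real.log (1 / ε) ≤ 1 := by
    have h2 := Real.log_le_sub_one_of_pos (one_div_pos.2 hε)
    calc ε * Real.log (1 / ε) ≤ ε * (1 / ε - 1) := mul_le_mul_of_nonneg_left h2 hε.le
      _ = 1 - ε := by field_simp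
      _ ≤ 1 := by linarith
  calc ENNReal.ofReal (Real.log (1 / ε))
      ≤ ENNReal.ofReal ((1 + Real.log 2) + (Real.log (1 / ε) * (1 - ε) - Real.log 2)) :=
        ENNReal.ofReal_le_ofReal (by linarith)
    _ ≤ _ := ENNReal.ofReal_add_le
    _ ≤ _ := by
        rw [add_assoc]
        gcongr
        exact ofReal_log_le_divergence η φ π C hac hh hκ hε hε1 hπ hT

theorem sum_tremble_mul_armDivergence_le {C' : ArmsConfig K S} {κ : ℝ≥0∞}
    (hκ : ∀ b a, 1 ≤ b.1 a → predictDiv C C' b a ≤ κ) (s : DelayState K S) (b : Fin K) :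
    ∑ a, tremble η b a * armDivergence C C' s a ≤ κ := by
  calc _ ≤ ∑ a, tremble η b a * κ := by
        gcongr with a _
        exact hκ (s.d, s.i) a (s.d_pos a)
    _ = κ := by rw [← Finset.sum_mul, PMF.sum_coe, one_mul]

/-- Each decision yields at most `κ` units of information against a dominating alternative, while
`log (1 / ε)` units are needed up to a constant. -/
theorem tendsto_totalVisits (hK : 2 ≤ K) {U : Filter ℝ} (hU : U ≤ 𝓝[>] 0)
    {π : ℝ → Policy K S} (hπ : ∀ᶠ ε in U, π ε ∈ admissible η φ ε)
    (hT : ∀ᶠ ε in U, totalVisits η φ (π ε) C ≠ ∞) :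
    Tendsto (fun ε => totalVisits η φ (π ε) C) U (𝓝 ∞) := by
  obtain ⟨C', hh, hac⟩ := exists_dominated hK C
  obtain ⟨κ, hκ', hκ⟩ := exists_predictDiv_le hac
  have hlog : Tendsto (fun ε : ℝ => ENNReal.ofReal (Real.log (1 / ε))) U (𝓝 ∞) := by
    refine ENNReal.tendsto_ofReal_nhds_top.2 (Tendsto.mono_left ?_ hU)
    simp only [one_div]
    exact Real.tendsto_log_atTop.comp tendsto_inv_nhdsGT_zero
  rw [ENNReal.tendsto_nhds_top_iff_nat]
  intro n
  have hlt : (ENNReal.ofReal (1 + Real.log 2) + K * κ) + n * κ < ∞ := by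
    finiteness
  have hpos : ∀ᶠ ε : ℝ in U, ε ∈ Set.Ioo (0 : ℝ) 1 := hU (Ioo_mem_nhdsGT one_pos)
  filter_upwards [hlog.eventually (eventually_gt_nhds hlt), hπ, hT, hpos] with ε h1 h2 h3 h4
  by_contra hle
  rw [not_lt] at hle
  refine (h1.trans_le ((ofReal_log_le_add_divergence η φ C (π ε) hac hh.symm hκ h4.1 h4.2.le h2
    h3).trans ?_)).false
  gcongr
  refine le_trans ?_ (mul_le_mul_left hle κ)
  rw [totalVisits, ← ENNReal.tsum_mul_right]
  refine ENNReal.tsum_le_tsum fun s => ?_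
  rw [Finset.sum_mul]
  exact Finset.sum_le_sum fun b _ =>
    mul_le_mul_right (sum_tremble_mul_armDivergence_le η C hκ s b) _

/-- If expected stopping times below `c * log (1 / ε)` are possible for arbitrarily small `ε`, then
some stationary randomised strategy gathers information at the rate `c⁻¹`. -/
theorem inv_le_Rstar (hK : 2 ≤ K) {U : Ultrafilter ℝ} (hU : (U : Filter ℝ) ≤ 𝓝[>] 0)
    {π : ℝ → Policy K S} {c : ℝ≥0∞} (hc0 : c ≠ 0) (hc : c ≠ ∞)
    (hπ : ∀ᶠ ε in (U : Filter ℝ), π ε ∈ admissible η φ ε)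
    (hτ : ∀ᶠ ε in (U : Filter ℝ), expectedStopTime η φ (π ε) C ≤
      c * ENNReal.ofReal (Real.log (1 / ε))) : c⁻¹ ≤ Rstar η C := by
  set T : ℝ → ℝ≥0∞ := fun ε => totalVisits η φ (π ε) C
  have hTc : ∀ᶠ ε in (U : Filter ℝ), T ε ≤ c * ENNReal.ofReal (Real.log (1 / ε)) :=
    hτ.mono fun ε h => (totalVisits_le η φ (π ε) C).trans h
  have hT : ∀ᶠ ε in (U : Filter ℝ), T ε ≠ ∞ :=
    hTc.mono fun ε h => ne_top_of_le_ne_top (ENNReal.mul_ne_top hc ENNReal.ofReal_ne_top) h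
  have hTlim : Tendsto T U (𝓝 ∞) := tendsto_totalVisits η φ C hK hU hπ hT
  have hT1 : ∀ᶠ ε in (U : Filter ℝ), 1 ≤ T ε :=
    (hTlim.eventually (eventually_gt_nhds ENNReal.one_lt_top)).mono fun _ h => h.le
  have hθ : Tendsto (fun ε => (T ε)⁻¹) U (𝓝 0) := by
    rw [← ENNReal.inv_top]
    exact tendsto_inv_iff.2 hTlim
  have hpos : ∀ᶠ ε in (U : Filter ℝ), ε ∈ Set.Ioo (0 : ℝ) 1 := hU (Ioo_mem_nhdsGT one_pos)
  have hηK : ENNReal.ofReal ((η : ℝ) / K) ≠ 0 := ofReal_div_ne_zero η C.h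
  let V : ℝ → DelayState K S → Fin K → ℝ≥0∞ := fun ε s b => visits η φ (π ε) C s b * (T ε)⁻¹
  have hVk (ε : ℝ) (k : DelayState K S → Fin K → ℝ≥0∞) : ∑' s, ∑ b, V ε s b * k s b =
      (∑' s, ∑ b, visits η φ (π ε) C s b * k s b) * (T ε)⁻¹ := by
    rw [← ENNReal.tsum_mul_right]
    refine tsum_congr fun s => ?_
    rw [Finset.sum_mul]
    exact Finset.sum_congr rfl fun b _ => by simp only [V]; ring
  have hVT : ∀ᶠ ε in (U : Filter ℝ), ∑' s, ∑ b, V ε s b = 1 := by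
    filter_upwards [hT, hT1] with ε h1 h2
    have := hVk ε fun _ _ => 1
    simp only [mul_one] at this
    rw [this]
    exact ENNReal.mul_inv_cancel (one_pos.trans_le h2).ne' h1
  -- After division by `T ≥ 1`, the bound `K + T` becomes at most `K + 1`, uniformly in `ε`.
  have hdelay : ∀ᶠ ε in (U : Filter ℝ), ∀ (a : Fin K) (m : ℕ),
      m * ∑' s, (if m ≤ s.d a then ∑ b, V ε s b else 0) ≤
        (ENNReal.ofReal ((η : ℝ) / K))⁻¹ * (K + 1) := by
    filter_upwards [hT, hT1] with ε h1 h2 a m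
    have h3 := mul_tsum_visits_delay_ge_le η φ (π ε) C h1 a m
    have h4 : ∑' s, (if m ≤ s.d a then ∑ b, V ε s b else 0) =
        (∑' s, (if m ≤ s.d a then ∑ b, visits η φ (π ε) C s b else 0)) * (T ε)⁻¹ := by
      rw [← ENNReal.tsum_mul_right]
      refine tsum_congr fun s => ?_
      split_ifs
      · exact (Finset.sum_mul _ _ _).symm
      · simp
    have h5 : (T ε)⁻¹ ≤ 1 := ENNReal.inv_le_one.2 h2
    rw [h4]
    set W := ∑' s, (if m ≤ s.d a then ∑ b, visits η φ (π ε) C s b else 0)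
    calc m * (W * (T ε)⁻¹) = (ENNReal.ofReal ((η : ℝ) / K))⁻¹ *
          ((ENNReal.ofReal ((η : ℝ) / K) * m * W) * (T ε)⁻¹) := by
          rw [mul_assoc (ENNReal.ofReal _), mul_assoc (ENNReal.ofReal _), ← mul_assoc,
            ← mul_assoc (ENNReal.ofReal _)⁻¹, ENNReal.inv_mul_cancel hηK ENNReal.ofReal_ne_top,
            one_mul]
      _ ≤ (ENNReal.ofReal ((η : ℝ) / K))⁻¹ * ((K + T ε) * (T ε)⁻¹) := by gcongr
      _ ≤ _ := by
          rw [add_mul, ENNReal.mul_inv_cancel (one_pos.trans_le h2).ne' h1]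
          gcongr
          calc (K : ℝ≥0∞) * (T ε)⁻¹ ≤ K * 1 := by gcongr
            _ = K := mul_one _
  have hcd : (ENNReal.ofReal ((η : ℝ) / K))⁻¹ * (K + 1) ≠ ∞ :=
    ENNReal.mul_ne_top (ENNReal.inv_ne_top.2 hηK) (by finiteness)
  have hv1 : ∑' s, ∑ b, ultralimit U V s b = 1 := by
    refine le_antisymm (ENNReal.summable.tsum_le_of_sum_le fun F => ?_) ?_
    · refine le_of_tendsto (tendsto_finsetSum F fun s _ =>
        tendsto_finsetSum _ fun b _ => tendsto_ultralimit U V s b) ?_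
      filter_upwards [hVT] with ε h
      exact (ENNReal.sum_le_tsum F).trans h.le
    -- No mass escapes: tightness applied to the constant function `1`.
    · have := le_tsum_ultralimit_mul U V hcd hdelay (k := fun _ _ => 1) ENNReal.one_ne_top
        (fun _ _ => le_rfl) (r := 1) (θ := fun _ => 0) tendsto_const_nhds
        (by filter_upwards [hVT] with ε h; simp [h])
      simpa using this
  have hv2 (s' : DelayState K S) := tsum_ultralimit_mul_transProb_le U V η C hθ s' (by
    filter_upwards with ε
    rw [hVk ε fun s b => transProb η C s b s']
    calc _ ≤ (∑ b, visits η φ (π ε) C s' b + 1) * (T ε)⁻¹ := by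
          gcongr
          exact tsum_visits_mul_transProb_le η φ (π ε) C s'
      _ = _ := by rw [add_mul, one_mul, Finset.sum_mul])
  obtain ⟨lam, μ, hst, hocc⟩ := exists_isStationary (by omega) η C hv1 hv2
  refine le_iSup₂_of_le lam μ (le_iSup_of_le hst (le_iInf₂ fun C' hh => ?_))
  -- The strategy was built without reference to `C'`, so the alternatives can be treated one at a
  -- time and no uniformity over them is needed.
  by_cases hac : Dominated C C'
  swap
  · rw [hst.tsum_occupancy_mul_eq_top hK hac]
    exact le_top
  obtain ⟨κ, hκ', hκ⟩ := exists_predictDiv_le hac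
  rw [hocc]
  refine le_tsum_ultralimit_mul U V hcd hdelay hκ' (sum_tremble_mul_armDivergence_le η C hκ)
    (θ := fun ε => (ENNReal.ofReal (1 + Real.log 2) + K * κ) * (T ε)⁻¹) ?_ ?_
  · have := ENNReal.Tendsto.const_mul (a := ENNReal.ofReal (1 + Real.log 2) + K * κ) hθ
      (Or.inr (by finiteness))
    simpa using this
  · filter_upwards [hT, hT1, hTc, hπ, hpos] with ε h1 h2 h3 h4 h5
    rw [hVk ε fun s b => ∑ a, tremble η b a * armDivergence C C' s a, ← add_mul]
    calc c⁻¹ = c⁻¹ * T ε * (T ε)⁻¹ := by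
          rw [mul_assoc, ENNReal.mul_inv_cancel (one_pos.trans_le h2).ne' h1, mul_one]
      _ ≤ c⁻¹ * (c * ENNReal.ofReal (Real.log (1 / ε))) * (T ε)⁻¹ := by gcongr
      _ = ENNReal.ofReal (Real.log (1 / ε)) * (T ε)⁻¹ := by
          rw [← mul_assoc c⁻¹, ENNReal.inv_mul_cancel hc0 hc, one_mul]
      _ ≤ _ := by
          gcongr
          exact ofReal_log_le_add_divergence η φ C (π ε) hac hh.symm hκ h5.1 h5.2.le h4 h1

end LowerBound

end OddArm

theorem proposition1 {K : ℕ} (hK : 3 ≤ K) {S : Type*} [Fintype S] [DecidableEq S]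
    [MeasurableSpace S] [DiscreteMeasurableSpace S] (η : Set.Ioc (0 : ℝ) 1) (φ : PMF S)
    (C : OddArm.ArmsConfig K S) :
    (OddArm.Rstar η C)⁻¹ ≤
      liminf (fun ε : ℝ => ⨅ π ∈ (OddArm.admissible η φ ε : Set (OddArm.Policy K S)),
        OddArm.expectedStopTime η φ π C / ENNReal.ofReal (Real.log (1 / ε))) (𝓝[>] 0) := by
  by_contra hlt
  rw [not_le] at hlt
  obtain ⟨c, hc, hcR⟩ := exists_between hlt
  have hfreq := frequently_lt_of_liminf_lt (by isBoundedDefault) hc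
  let A : Set ℝ := {ε | ∃ π ∈ OddArm.admissible η φ ε,
    OddArm.expectedStopTime η φ π C ≤ c * ENNReal.ofReal (Real.log (1 / ε))}
  have hfreq' : ∃ᶠ ε in 𝓝[>] (0 : ℝ), ε ∈ A := by
    refine (hfreq.and_eventually (Ioo_mem_nhdsGT one_pos)).mono fun ε hε => ?_
    obtain ⟨h1, h2⟩ := hε
    obtain ⟨π, h3⟩ := iInf_lt_iff.1 h1
    obtain ⟨hπ, h4⟩ := iInf_lt_iff.1 h3
    have hlog : 0 < Real.log (1 / ε) := Real.log_pos ((one_lt_div h2.1).2 h2.2)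
    exact ⟨π, hπ, (ENNReal.div_le_iff_le_mul (Or.inl (ENNReal.ofReal_pos.2 hlog).ne')
      (Or.inl ENNReal.ofReal_ne_top)).1 h4.le⟩
  have : (𝓝[>] (0 : ℝ) ⊓ 𝓟 A).NeBot := frequently_mem_iff_neBot.1 hfreq'
  -- The ultrafilter turns "for arbitrarily small `ε`" into "eventually" and makes all the limits
  -- exist at once.
  let U : Ultrafilter ℝ := Ultrafilter.of (𝓝[>] (0 : ℝ) ⊓ 𝓟 A)
  have hU : (U : Filter ℝ) ≤ _ := Ultrafilter.of_le _
  have hUA := le_principal_iff.1 (hU.trans inf_le_right)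
  have : Nonempty (OddArm.Policy K S) := ⟨fun _ _ => Sum.inr C.h⟩
  choose! π hπ using fun (ε : ℝ) (hε : ε ∈ A) => hε
  have key : c⁻¹ ≤ OddArm.Rstar η C :=
    OddArm.inv_le_Rstar η φ C (by omega) (hU.trans inf_le_left) (π := π)
      (zero_le.trans_lt hc).ne' hcR.ne_top (mem_of_superset hUA fun ε hε => (hπ ε hε).1)
      (mem_of_superset hUA fun ε hε => (hπ ε hε).2)
  exact (ENNReal.lt_inv_iff_lt_inv.1 hcR).not_ge key
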